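/- **Setting.** Let $\Phi=\{x_n\}$ be a homogeneous Poisson point process of intensity $\lambda>0$ on $\mathbb R^2$ (the base stations), seen by a user at the origin. Let $M\ge 1$ be an integer, and for $1\le i\le M$ let the $i$-th sector $S_M(i)$ be the set of points of the plane with angle in $[2\pi (i-1)/M,\,2\pi i/M)$. Let $\Gamma>0$ (detection threshold), $P>0$ (transmit power) and $W\ge 0$ (noise power). The path loss is dual-slope, $$l(r)=C_L r^{\alpha_L}\ (r<R_c),\qquad l(r)=C_N r^{\alpha_N}\ (r\ge R_c),$$ with $C_L,C_N,R_c>0$ and $\alpha_N\ge\max(\alpha_L,2)$, and it is assumed to be non-decreasing on $[0,\infty)$. In every cycle $n=1,2,\dots$ every base station $x_m$ has a fading variable $F_m(n)$; all the $F_m(n)$ are i.i.d. exponential with mean $1$ and independent of $\Phi$, while $\Phi$ is the same in all cycles. Let $x_0^i$ be the base station of smallest path loss (that is, the closest one) in $\Phi\cap S_M(i)$; it exists and is unique almost surely. Sector $i$ is detected in cycle $n$ if $$\frac{F_{0}^i(n)/l(\|x_0^i\|)}{\sum_{x_m\in\Phi\cap S_M(i)\setminus\{x_0^i\}}F_m(n)/l(\|x_m\|)+W/(PM)}>\Gamma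 ,$$ where $F_0^i(n)$ is the fading variable of $x_0^i$ and the ratio is $0$ if the sum is infinite. A cycle is successful if at least one of the $M$ sectors is detected in it, and $$L_{cs}(M,\lambda)=\inf\{n\ge 1:\ \text{cycle } n \text{ is successful}\}\in\{1,2,\dots\}\cup\{\infty\}.$$ Finally put $$F_M(i,\Phi)=\exp\Bigl(-\frac{W\Gamma\, l(\|x_0^i\|)}{PM}\Bigr)\prod_{x_m\in\Phi\cap S_M(i)\setminus\{x_0^i\}}\frac{1}{1+\Gamma\, l(\|x_0^i\|)/l(\|x_m\|)} .$$ **Theorem.** As an equality in $[0,\infty]$, $$\mathbb E[L_{cs}(M,\lambda)]=\sum_{j=0}^\infty A_j^M ,\qquad A_j=\mathbb E\bigl[(1-F_M(1,\Phi))^j\bigr],$$ and for every $j\ge 0$ $$A_j=\int_0^\infty\Biggl\{\sum_{k=0}^{j}(-1)^k\binom jk \exp\Bigl(-\frac{Wk\Gamma\, l(r_1)}{PM}\Bigr)\exp\Bigl(-\frac{2\pi\lambda}{M}\int_{r_1}^\infty\Bigl(1-\frac{1}{(1+\Gamma\, l(r_1)/l(r))^k}\Bigr)r\,dr\Bigr)\Biggr\}\frac{2\lambda\pi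 r_1}{M}\exp\Bigl(-\frac{\lambda\pi r_1^2}{M}\Bigr)\,dr_1 .$$ Here $L_{cs}(M,\lambda)$ is a random variable up to a null set, the expectation defining $A_j$ and the outer integral converge absolutely, and the inner integral has a non-negative integrand and may be infinite, in which case its exponential factor is $0$. -/

import Mathlib

open MeasureTheory ProbabilityTheory Set
open scoped ENNReal NNReal

noncomputable section

namespace CellSearch

/-! ### Poisson base stations

The plane is identified with `ℂ` (Euclidean norm, Lebesgue measure). A point process with
infinitely many points is given by an enumeration `X 0, X 1, …` of its (random) points. -/

/-- The number of points of the configuration `x` in `B`, counted with multiplicity. -/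
def pointCount (x : ℕ → ℂ) (B : Set ℂ) : ℝ≥0∞ := ∑' n, B.indicator 1 (x n)

/-- The points `X 0, X 1, …` form a homogeneous Poisson point process of intensity `lam` on the
plane: the number of points in a Borel set `B` of finite area is Poisson distributed with mean
`lam * area B`, and the numbers of points in finitely many disjoint such sets are independent. -/
structure IsPoissonPointProcess {Ω : Type*} [MeasurableSpace Ω] (X : ℕ → Ω → ℂ) (lam : ℝ)
    (μ : Measure Ω) : Prop where
  measurable_point : ∀ n, Measurable (X n)
  law_count : ∀ B : Set ℂ, MeasurableSet B → volume B ≠ ∞ →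
    μ.map (fun ω => pointCount (fun n => X n ω) B) =
      (poissonMeasure (lam * (volume B).toReal).toNNReal).map (Nat.cast : ℕ → ℝ≥0∞)
  indep_count : ∀ (m : ℕ) (B : Fin m → Set ℂ), (∀ i, MeasurableSet (B i)) →
    (∀ i, volume (B i) ≠ ∞) → Pairwise (fun i j => Disjoint (B i) (B j)) →
    iIndepFun (fun i ω => pointCount (fun n => X n ω) (B i)) μ

/-! ### Path loss, sectors, fading -/

/-- The dual-slope path loss at distance `r`. -/
def dualSlope (CL CN αL αN RC : ℝ) (r : ℝ) : ℝ :=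
  if r < RC then CL * r ^ αL else CN * r ^ αN

/-- The angle of `z`, in `[0, 2π)`. -/
def angle (z : ℂ) : ℝ := toIcoMod Real.two_pi_pos 0 (Complex.arg z)

/-- The `i`-th of the `M` sectors, `1 ≤ i ≤ M`: the points with angle in
`[2π(i-1)/M, 2πi/M)`. -/
def sector (M i : ℕ) : Set ℂ :=
  {z | angle z ∈ Ico (2 * Real.pi * ((i : ℝ) - 1) / M) (2 * Real.pi * (i : ℝ) / M)}

/-- Base station `k` provides the smallest path loss to the origin among all base stations in
sector `i`; if the path loss is constant on some range of distances, ties are resolved in favour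
of the closest base station. -/
def IsBest (l : ℝ → ℝ) (M : ℕ) (x : ℕ → ℂ) (i k : ℕ) : Prop :=
  x k ∈ sector M i ∧ ∀ m, x m ∈ sector M i →
    l ‖x k‖ < l ‖x m‖ ∨ (l ‖x k‖ = l ‖x m‖ ∧ ‖x k‖ ≤ ‖x m‖)

open Classical in
/-- Total interference in sector `i` (possibly infinite) when base station `k` is to be detected:
the sum of `f m / l ‖x m‖` over the other base stations `m` in the sector. -/
def interference (l : ℝ → ℝ) (M : ℕ) (x : ℕ → ℂ) (f : ℕ → ℝ) (i k : ℕ) : ℝ≥0∞ :=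
  ∑' m, if x m ∈ sector M i ∧ m ≠ k then ENNReal.ofReal (f m / l ‖x m‖) else 0

/-- The signal-to-interference-plus-noise ratio of base station `k` in sector `i`; `Pw` is the
transmit power, `W` the noise power, `f m` the fading of the link from base station `m`. An
infinite interference gives the value `0`. -/
def sinr (l : ℝ → ℝ) (M : ℕ) (Pw W : ℝ) (x : ℕ → ℂ) (f : ℕ → ℝ) (i k : ℕ) : ℝ≥0∞ :=
  ENNReal.ofReal (f k / l ‖x k‖) /
    (interference l M x f i k + ENNReal.ofReal (W / (Pw * M)))

/-- Sector `i` is detected: the SINR of its best base station exceeds the threshold `Γ`. -/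
def SectorDetected (l : ℝ → ℝ) (M : ℕ) (Γ Pw W : ℝ) (x : ℕ → ℂ) (f : ℕ → ℝ) (i : ℕ) : Prop :=
  ∃ k, IsBest l M x i k ∧ ENNReal.ofReal Γ < sinr l M Pw W x f i k

/-- Cell search succeeds in a cycle: at least one of the `M` sectors is detected. -/
def CycleSuccess (l : ℝ → ℝ) (M : ℕ) (Γ Pw W : ℝ) (x : ℕ → ℂ) (f : ℕ → ℝ) : Prop :=
  ∃ i, 1 ≤ i ∧ i ≤ M ∧ SectorDetected l M Γ Pw W x f i

/-- The number of cycles to succeed in cell search, `inf {n ≥ 1 : cycle n is successful}`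
(`∞` if no cycle is). The base stations are fixed; `f n m` is the fading of the link from base
station `m` in cycle `n`. -/
def numCycles (l : ℝ → ℝ) (M : ℕ) (Γ Pw W : ℝ) (x : ℕ → ℂ) (f : ℕ → ℕ → ℝ) : ℝ≥0∞ :=
  ⨅ (n : ℕ) (_ : 1 ≤ n ∧ CycleSuccess l M Γ Pw W x (f n)), (n : ℝ≥0∞)

/-! ### The detection probability given the base stations, and its moments -/

open Classical in
/-- With base station `k` the best one in sector `i`:
`exp (- W Γ l(‖x k‖) / (Pw M)) * ∏ 1 / (1 + Γ l(‖x k‖) / l(‖x m‖))`, the product over the other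
base stations `m` in the sector (its factors lie in `(0, 1]`, so it always converges, possibly
to `0`). -/
def detectProbAt (l : ℝ → ℝ) (M : ℕ) (Γ Pw W : ℝ) (x : ℕ → ℂ) (i k : ℕ) : ℝ :=
  Real.exp (-(W * Γ * l ‖x k‖ / (Pw * M))) *
    ∏' m, if x m ∈ sector M i ∧ m ≠ k then 1 / (1 + Γ * l ‖x k‖ / l ‖x m‖) else 1

open Classical in
/-- The function `F_M(i, Φ)` of the configuration `Φ = x`, with value `0` if sector `i` has no best
base station (for a Poisson process this is an event of probability zero). -/
def detectProb (l : ℝ → ℝ) (M : ℕ) (Γ Pw W : ℝ) (x : ℕ → ℂ) (i : ℕ) : ℝ :=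
  if h : ∃ k, IsBest l M x i k then detectProbAt l M Γ Pw W x i (Nat.find h) else 0

/-- `A_j = E[(1 - F_M(1, Φ)) ^ j]`. -/
def missMoment {Ω : Type*} [MeasurableSpace Ω] (μ : Measure Ω) (l : ℝ → ℝ) (M : ℕ)
    (Γ Pw W : ℝ) (X : ℕ → Ω → ℂ) (j : ℕ) : ℝ :=
  ∫ ω, (1 - detectProb l M Γ Pw W (fun n => X n ω) 1) ^ j ∂μ

/-- The factor
`exp (-(2πλ/M) ∫_{r₁}^∞ (1 - 1 / (1 + Γ l(r₁) / l(r)) ^ k) r dr)`. The integrand is nonnegative,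
the integral may be infinite, and then the factor is `0`. -/
def interferenceFactor (l : ℝ → ℝ) (M : ℕ) (Γ lam : ℝ) (k : ℕ) (r₁ : ℝ) : ℝ :=
  (EReal.exp (-((ENNReal.ofReal (2 * Real.pi * lam / M) *
    ∫⁻ r in Ioi r₁, ENNReal.ofReal ((1 - 1 / (1 + Γ * l r₁ / l r) ^ k) * r) : ℝ≥0∞) :
      EReal))).toReal

/-- The integrand of the explicit formula for `A_j`. -/
def missIntegrand (l : ℝ → ℝ) (M : ℕ) (Γ Pw W lam : ℝ) (j : ℕ) (r₁ : ℝ) : ℝ :=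
  (∑ k ∈ Finset.range (j + 1), (-1) ^ k * (j.choose k : ℝ) *
    Real.exp (-(W * k * Γ * l r₁ / (Pw * M))) * interferenceFactor l M Γ lam k r₁) *
  (2 * lam * Real.pi * r₁ / M * Real.exp (-(lam * Real.pi * r₁ ^ 2 / M)))

end CellSearch

end

open Filter Topology

/-! The number of cycles equals the number of `j ≥ 0` such that the first `j` cycles all fail, so
its expectation is the sum over `j` of the probabilities of these events. Fix the base stations.
Multiplying out the SINR, sector `i` is detected when the exponential fading of its closest station
exceeds an independent nonnegative variable `Y` (noise plus weighted interference). This has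
probability `E[exp (-Y)]`, which the Laplace transform `1 / (1 + s)` of each interferer turns into
`F_M(i, Φ)`. Different pairs (cycle, sector) read disjoint sets of fading variables, so `j` cycles
fail with conditional probability `∏ i, (1 - F_M(i, Φ)) ^ j` (`measure_forall_not_cycleSuccess`).
Averaging over `Φ`, with the sectors independent and of equal moments, gives `A_j ^ M`
(`integral_prod_one_sub_detectProb_pow`, `measure_failure`).

The formula for `A_j` follows from the binomial theorem and the moments `E[F_M ^ k]`. The hypothesis
on `Φ` only speaks of counts in sets, so these moments are reached by discretisation. Each sector is
cut into annular cells of width `2⁻ⁿ` up to radius `2ⁿ`, with independent Poisson counts, and `-log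
F_M` is replaced by the function `levelExponent` of the counts. Its transform is an explicit sum
over the first nonempty cell (`lintegral_nexp_levelExponent`). This sum is an integral against the
exact law of the closest distance (`levelSum_eq_lintegral`) and converges to the desired one
(`tendsto_levelSum`). On the other side `levelExponent` converges almost surely to the true exponent
(`tendsto_levelExponent`). The same approximation supplies the measurability of `F_M(i, Φ)` and
carries the independence of the sectors to the limit.

Exponents live in `[0, ∞]`, where `nexp` is continuous with `nexp ∞ = 0`; a divergent interference
sum or integral thus needs no separate treatment. -/

namespace CellSearch

/-! ### The function `s ↦ exp (-s)` on `[0, ∞]` -/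

/-- The function `s ↦ exp (-s)` on `[0, ∞]`. -/
noncomputable def nexp (s : ℝ≥0∞) : ℝ≥0∞ := EReal.exp (-(s : EReal))

@[simp] lemma nexp_zero : nexp 0 = 1 := by simp [nexp]

@[simp] lemma nexp_top : nexp ∞ = 0 := by simp [nexp]

lemma nexp_add (s t : ℝ≥0∞) : nexp (s + t) = nexp s * nexp t := by
  simp only [nexp, EReal.coe_ennreal_add]
  rw [EReal.neg_add (by simp) (by simp), sub_eq_add_neg, EReal.exp_add]

lemma nexp_ofReal {t : ℝ} (ht : 0 ≤ t) :
    nexp (ENNReal.ofReal t) = ENNReal.ofReal (Real.exp (-t)) := by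
  rw [nexp, EReal.coe_ennreal_ofReal, max_eq_left ht, ← EReal.coe_neg, EReal.exp_coe]

lemma nexp_antitone : Antitone nexp := fun s t h => by
  simp only [nexp, EReal.exp_le_exp_iff, EReal.neg_le_neg_iff]
  exact_mod_cast h

lemma nexp_le_one (s : ℝ≥0∞) : nexp s ≤ 1 := by
  simpa using nexp_antitone (zero_le (a := s))

lemma nexp_ne_top (s : ℝ≥0∞) : nexp s ≠ ∞ := ne_top_of_le_ne_top ENNReal.one_ne_top (nexp_le_one s)

lemma continuous_nexp : Continuous nexp :=
  ENNReal.continuous_exp.comp (continuous_neg.comp continuous_coe_ennreal_ereal)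

@[fun_prop]
lemma measurable_nexp : Measurable nexp := continuous_nexp.measurable

lemma nexp_sum {ι : Type*} (s : Finset ι) (f : ι → ℝ≥0∞) :
    nexp (∑ i ∈ s, f i) = ∏ i ∈ s, nexp (f i) := by
  classical
  induction s using Finset.induction_on with
  | empty => simp
  | insert a s ha ih => rw [Finset.sum_insert ha, Finset.prod_insert ha, nexp_add, ih]

lemma nexp_natCast_mul (k : ℕ) (s : ℝ≥0∞) : nexp (k * s) = nexp s ^ k := by
  induction k with
  | zero => simp
  | succ k ih => rw [Nat.cast_succ, add_mul, one_mul, nexp_add, ih, pow_succ]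

lemma nexp_log_one_add {s : ℝ} (hs : 0 ≤ s) :
    nexp (ENNReal.ofReal (Real.log (1 + s))) = ENNReal.ofReal (1 / (1 + s)) := by
  rw [nexp_ofReal (Real.log_nonneg (by linarith)), Real.exp_neg, Real.exp_log (by linarith),
    one_div]

lemma toReal_nexp_le_one (s : ℝ≥0∞) : (nexp s).toReal ≤ 1 := by
  simpa using ENNReal.toReal_mono ENNReal.one_ne_top (nexp_le_one s)

/-- Sums in `[0, ∞]` always converge and `nexp` is continuous there, also at `∞`. Hence infinite
products of factors in `[0, 1]` can be handled through their exponents, even when the product is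
`0`. -/
lemma hasProd_toReal_nexp {ι : Type*} (f : ι → ℝ≥0∞) :
    HasProd (fun i => (nexp (f i)).toReal) (nexp (∑' i, f i)).toReal := by
  have h := (ENNReal.tendsto_toReal (nexp_ne_top (∑' i, f i))).comp
    ((continuous_nexp.tendsto _).comp (ENNReal.summable (f := f)).hasSum)
  refine h.congr fun s => ?_
  simp [nexp_sum, ENNReal.toReal_prod]

/-! ### Limits of integrals and sums -/

/-- Fatou gives the lower bound, domination by the limit itself the upper one. Neither monotonicity
in `n` nor finiteness of `∫ g` is needed, so infinite interference is allowed. -/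
lemma tendsto_lintegral_of_le {α : Type*} [MeasurableSpace α] {ν : Measure α}
    {f : ℕ → α → ℝ≥0∞} {g : α → ℝ≥0∞} (hf : ∀ n, AEMeasurable (f n) ν)
    (hle : ∀ n, ∀ᵐ a ∂ν, f n a ≤ g a) (hlim : ∀ᵐ a ∂ν, Tendsto (fun n => f n a) atTop (𝓝 (g a))) :
    Tendsto (fun n => ∫⁻ a, f n a ∂ν) atTop (𝓝 (∫⁻ a, g a ∂ν)) := by
  refine tendsto_of_le_liminf_of_limsup_le ?_ ?_
  · calc ∫⁻ a, g a ∂ν = ∫⁻ a, liminf (fun n => f n a) atTop ∂ν :=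
          lintegral_congr_ae (hlim.mono fun a h => h.liminf_eq.symm)
      _ ≤ _ := lintegral_liminf_le' hf
  · exact limsup_le_of_le (by isBoundedDefault)
      (Eventually.of_forall fun n => lintegral_mono_ae (hle n))

lemma tendsto_tsum_of_le {ι : Type*} {f : ℕ → ι → ℝ≥0∞} {g : ι → ℝ≥0∞}
    (hle : ∀ n i, f n i ≤ g i) (hlim : ∀ i, Tendsto (fun n => f n i) atTop (𝓝 (g i))) :
    Tendsto (fun n => ∑' i, f n i) atTop (𝓝 (∑' i, g i)) := by
  let _ : MeasurableSpace ι := ⊤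
  simp only [← lintegral_count]
  exact tendsto_lintegral_of_le (fun n => measurable_from_top.aemeasurable)
    (fun n => Eventually.of_forall (hle n)) (Eventually.of_forall hlim)

/-! ### Independence of disjoint blocks -/

/-- Independence says that the joint law is a product measure; currying the index set turns a
product over pairs into a product of products. -/
lemma iIndepFun_curry {Ω ι β : Type*} {κ : ι → Type*} [MeasurableSpace Ω] [MeasurableSpace β]
    {μ : Measure Ω} {X : (i : ι) → κ i → Ω → β} (mX : ∀ i j, Measurable (X i j))
    (h : iIndepFun (fun (p : (i : ι) × κ i) => X p.1 p.2) μ) :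
    iIndepFun (fun i ω (j : κ i) => X i j ω) μ := by
  have := h.isProbabilityMeasure
  have : ∀ i j, IsProbabilityMeasure (μ.map (X i j)) :=
    fun i j => Measure.isProbabilityMeasure_map (mX i j).aemeasurable
  have hblock : ∀ i, iIndepFun (X i) μ := fun i =>
    h.precomp (g := fun j => (⟨i, j⟩ : (i : ι) × κ i)) sigma_mk_injective
  have e : (MeasurableEquiv.piCurry (fun i (_ : κ i) => β)) ∘ (fun ω p => X p.1 p.2 ω) =
      fun ω i j => X i j ω := by
    ext; simp [Sigma.curry]
  rw [iIndepFun_iff_map_fun_eq_infinitePi_map (by fun_prop), ← e,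
    ← Measure.map_map (by fun_prop) (by fun_prop),
    (iIndepFun_iff_map_fun_eq_infinitePi_map (by fun_prop)).1 h,
    Measure.infinitePi_map_piCurry (fun i j => μ.map (X i j))]
  congr 1
  funext i
  rw [(iIndepFun_iff_map_fun_eq_infinitePi_map (by fun_prop)).1 (hblock i)]

lemma iIndepFun_blocks {Ω ι κ β : Type*} [MeasurableSpace Ω] [MeasurableSpace β]
    {μ : Measure Ω} {X : ι → Ω → β} (mX : ∀ i, Measurable (X i)) (h : iIndepFun X μ)
    (S : κ → Set ι) (hS : Pairwise fun a b => Disjoint (S a) (S b)) :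
    iIndepFun (fun a ω (j : S a) => X j ω) μ := by
  refine iIndepFun_curry (X := fun a (j : S a) => X j) (fun a j => mX j) ?_
  refine h.precomp (g := fun p : (a : κ) × S a => (p.2 : ι)) ?_
  rintro ⟨a, i, hi⟩ ⟨b, j, hj⟩ hij
  obtain rfl : i = j := hij
  obtain rfl : a = b := by
    by_contra hab
    exact Set.disjoint_left.1 (hS hab) hi hj
  rfl

/-! ### Exponential and Poisson variables -/

section Laws

variable {Ω : Type*} [MeasurableSpace Ω] {μ : Measure Ω}

lemma measure_lt_ofReal_expMeasure (c : ℝ≥0∞) :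
    expMeasure 1 {a | c < ENNReal.ofReal a} = nexp c := by
  have := isProbabilityMeasure_expMeasure one_pos
  induction c with
  | top => simp
  | coe t =>
    have e : {a : ℝ | (t : ℝ≥0∞) < ENNReal.ofReal a} = (Iic (t : ℝ))ᶜ := by
      ext a
      rw [mem_ofPred_eq, ENNReal.lt_ofReal_iff_toReal_lt (by simp)]
      simp
    rw [e, measure_compl measurableSet_Iic (measure_ne_top _ _), measure_univ,
      ← ofReal_cdf, cdf_expMeasure_eq one_pos, if_pos (NNReal.coe_nonneg t), ← ENNReal.ofReal_one,
      ← ENNReal.ofReal_sub _ (by simp), ← ENNReal.ofReal_coe_nnreal,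
      nexp_ofReal (NNReal.coe_nonneg t)]
    simp

lemma lintegral_nexp_expMeasure {s : ℝ} (hs : 0 ≤ s) :
    ∫⁻ a, nexp (ENNReal.ofReal s * ENNReal.ofReal a) ∂(expMeasure 1) =
      nexp (ENNReal.ofReal (Real.log (1 + s))) := by
  have h0 : (0 : ℝ) < 1 + s := by linarith
  have hm : Measurable fun a : ℝ => nexp (ENNReal.ofReal s * ENNReal.ofReal a) := by fun_prop
  have hd : expMeasure 1 = volume.withDensity (exponentialPDF 1) := rfl
  have hpm : ∀ r, Measurable (exponentialPDF r) := fun r =>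
    (measurable_exponentialPDFReal r).ennreal_ofReal
  rw [hd, lintegral_withDensity_eq_lintegral_mul _ (hpm 1) hm, nexp_log_one_add hs]
  -- Exponential tilting: the weighted density of rate `1` is `1 / (1 + s)` times the density of
  -- rate `1 + s`, which has total mass `1`.
  have e : ∀ a, (exponentialPDF 1 * fun a => nexp (ENNReal.ofReal s * ENNReal.ofReal a)) a =
      ENNReal.ofReal (1 / (1 + s)) * exponentialPDF (1 + s) a := by
    intro a
    rw [Pi.mul_apply]
    rcases lt_or_ge a 0 with ha | ha
    · simp [exponentialPDF_of_neg ha]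
    · rw [exponentialPDF_of_nonneg ha, exponentialPDF_of_nonneg ha, ← ENNReal.ofReal_mul hs,
        nexp_ofReal (by positivity), ← ENNReal.ofReal_mul (by positivity),
        ← ENNReal.ofReal_mul (by positivity), one_mul, ← Real.exp_add, ← mul_assoc,
        one_div_mul_cancel h0.ne', one_mul]
      ring_nf
  simp_rw [e]
  rw [lintegral_const_mul _ (hpm _), lintegral_exponentialPDF_eq_one h0, mul_one]

/-- Conditionally on `Y`, the probability is the exponential tail `nexp Y`; the value `Y = ∞`
contributes `0`. -/
lemma measure_lt_ofReal_of_indepFun [IsProbabilityMeasure μ] {T : Ω → ℝ} {Y : Ω → ℝ≥0∞}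
    (hT : Measurable T) (hY : Measurable Y) (hlaw : μ.map T = expMeasure 1)
    (hind : IndepFun Y T μ) :
    μ {ω | Y ω < ENNReal.ofReal (T ω)} = ∫⁻ ω, nexp (Y ω) ∂μ := by
  have hset : MeasurableSet {p : ℝ≥0∞ × ℝ | p.1 < ENNReal.ofReal p.2} :=
    measurableSet_lt measurable_fst (measurable_snd.ennreal_ofReal)
  have hprod := (indepFun_iff_map_prod_eq_prod_map_map hY.aemeasurable hT.aemeasurable).1 hind
  have e : {ω | Y ω < ENNReal.ofReal (T ω)} =
      (fun ω => (Y ω, T ω)) ⁻¹' {p : ℝ≥0∞ × ℝ | p.1 < ENNReal.ofReal p.2} := rfl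
  have := isProbabilityMeasure_expMeasure one_pos
  rw [e, ← Measure.map_apply (hY.prodMk hT) hset, hprod, hlaw, Measure.prod_apply hset]
  simp only [preimage_ofPred_eq, measure_lt_ofReal_expMeasure]
  rw [lintegral_map measurable_nexp hY]

/-- Independence factorises the finite partial sums; both sides then pass to the limit, the left one
by domination by `1`. -/
lemma lintegral_nexp_tsum_exponential [IsProbabilityMeasure μ] {F : ℕ → Ω → ℝ}
    (hF : ∀ m, Measurable (F m)) (hlaw : ∀ m, μ.map (F m) = expMeasure 1)
    (hind : iIndepFun F μ) {s : ℕ → ℝ} (hs : ∀ m, 0 ≤ s m) :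
    ∫⁻ ω, nexp (∑' m, ENNReal.ofReal (s m) * ENNReal.ofReal (F m ω)) ∂μ =
      nexp (∑' m, ENNReal.ofReal (Real.log (1 + s m))) := by
  have h1 : ∀ K : ℕ, ∫⁻ ω, nexp (∑ m ∈ Finset.range K,
      ENNReal.ofReal (s m) * ENNReal.ofReal (F m ω)) ∂μ =
      nexp (∑ m ∈ Finset.range K, ENNReal.ofReal (Real.log (1 + s m))) := by
    intro K
    simp_rw [nexp_sum]
    rw [lintegral_prod_eq_prod_lintegral_of_indepFun (Finset.range K)
      (fun m ω => nexp (ENNReal.ofReal (s m) * ENNReal.ofReal (F m ω)))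
      (hind.comp (fun m a => nexp (ENNReal.ofReal (s m) * ENNReal.ofReal a))
        (fun m => by fun_prop)) (fun m => by fun_prop)]
    refine Finset.prod_congr rfl fun m _ => ?_
    rw [← lintegral_nexp_expMeasure (hs m), ← hlaw m, lintegral_map (by fun_prop) (hF m)]
  refine tendsto_nhds_unique (f := fun K : ℕ => ∫⁻ ω, nexp (∑ m ∈ Finset.range K,
      ENNReal.ofReal (s m) * ENNReal.ofReal (F m ω)) ∂μ) (l := atTop) ?_ ?_
  · refine tendsto_lintegral_of_dominated_convergence (fun _ => 1) (fun K => by fun_prop)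
      (fun K => Eventually.of_forall fun ω => nexp_le_one _) (by simp) ?_
    exact Eventually.of_forall fun ω =>
      (continuous_nexp.tendsto _).comp ENNReal.summable.hasSum.tendsto_sum_nat
  · simp_rw [h1]
    exact (continuous_nexp.tendsto _).comp ENNReal.summable.hasSum.tendsto_sum_nat

lemma lintegral_pow_poissonMeasure (r : ℝ≥0) {a : ℝ} (ha : 0 ≤ a) (ha1 : a ≤ 1) :
    ∫⁻ n, ENNReal.ofReal a ^ n ∂(poissonMeasure r) = nexp (ENNReal.ofReal (r * (1 - a))) := by
  lift a to ℝ≥0 using ha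
  rw [lintegral_countable']
  simp_rw [poissonMeasure_singleton, ← ENNReal.ofReal_pow a.coe_nonneg]
  -- The Poisson weights of mean `r` times `a ^ n` are `exp (-r (1 - a))` times those of mean `r *
  -- a`, which sum to `1`.
  have h := ((hasSum_one_poissonMeasure (r * a)).mul_left (Real.exp (-(r * (1 - a)))))
  have e : ∀ n : ℕ, ENNReal.ofReal ((a : ℝ) ^ n) *
      ENNReal.ofReal (Real.exp (-r) * r ^ n / n.factorial) =
      ENNReal.ofReal (Real.exp (-(r * (1 - a))) * (Real.exp (-(r * a : ℝ≥0)) *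
        ((r * a : ℝ≥0) : ℝ) ^ n / n.factorial)) := by
    intro n
    rw [← ENNReal.ofReal_mul (by positivity)]
    congr 1
    have h2 : Real.exp (-(r : ℝ)) = Real.exp (-(r * (1 - a))) * Real.exp (-(r * a : ℝ≥0)) := by
      rw [← Real.exp_add, NNReal.coe_mul]
      ring_nf
    rw [h2, NNReal.coe_mul, mul_pow]
    ring
  simp_rw [e]
  rw [← ENNReal.ofReal_tsum_of_nonneg (fun n => by positivity) h.summable, h.tsum_eq, mul_one,
    nexp_ofReal (mul_nonneg r.coe_nonneg (by linarith))]

end Laws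

/-! ### Path loss functions and regular configurations -/

/-- The properties of the path loss that matter: it is measurable, non-decreasing, positive away
from the origin, and continuous at all distances but one. -/
structure IsPathLoss (l : ℝ → ℝ) (RC : ℝ) : Prop where
  measurable : Measurable l
  mono : MonotoneOn l (Ici 0)
  nonneg : ∀ r, 0 ≤ r → 0 ≤ l r
  pos : ∀ r, 0 < r → 0 < l r
  continuousAt : ∀ r, 0 < r → r ≠ RC → ContinuousAt l r

lemma isPathLoss_dualSlope {CL CN αL αN RC : ℝ} (hCL : 0 < CL) (hCN : 0 < CN)
    (hmono : MonotoneOn (dualSlope CL CN αL αN RC) (Ici 0)) :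
    IsPathLoss (dualSlope CL CN αL αN RC) RC where
  measurable := by
    unfold dualSlope
    exact Measurable.ite measurableSet_Iio (by fun_prop) (by fun_prop)
  mono := hmono
  nonneg r hr := by
    unfold dualSlope
    split_ifs <;> positivity
  pos r hr := by
    unfold dualSlope
    split_ifs <;> positivity
  continuousAt r hr hne := by
    rcases lt_or_gt_of_ne hne with h | h
    · have e : (fun r => CL * r ^ αL) =ᶠ[𝓝 r] dualSlope CL CN αL αN RC := by
        filter_upwards [Iio_mem_nhds h] with s hs
        exact (if_pos hs).symm
      exact ((Real.continuousAt_rpow_const r αL (Or.inl hr.ne')).const_mul CL).congr e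
    · have e : (fun r => CN * r ^ αN) =ᶠ[𝓝 r] dualSlope CL CN αL αN RC := by
        filter_upwards [Ioi_mem_nhds h] with s hs
        exact (if_neg (not_lt.2 (le_of_lt hs))).symm
      exact ((Real.continuousAt_rpow_const r αN (Or.inl hr.ne')).const_mul CN).congr e

/-- The properties that the configurations of a Poisson process have almost surely. -/
structure IsRegular (M : ℕ) (RC : ℝ) (x : ℕ → ℂ) : Prop where
  norm_pos : ∀ m, 0 < ‖x m‖
  norm_ne : ∀ m, ‖x m‖ ≠ RC
  norm_inj : ∀ i m m', 1 ≤ i → i ≤ M → x m ∈ sector M i → x m' ∈ sector M i →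
    ‖x m‖ = ‖x m'‖ → m = m'
  finite : ∀ R : ℝ, {m | ‖x m‖ < R}.Finite
  exists_mem : ∀ i, 1 ≤ i → i ≤ M → ∃ m, x m ∈ sector M i

/-- Base station `k` is strictly closer to the origin than all others in sector `i`. -/
def IsClosest (M : ℕ) (x : ℕ → ℂ) (i k : ℕ) : Prop :=
  x k ∈ sector M i ∧ ∀ m, x m ∈ sector M i → m ≠ k → ‖x k‖ < ‖x m‖

lemma IsRegular.exists_isClosest {M : ℕ} {RC : ℝ} {x : ℕ → ℂ} (hx : IsRegular M RC x) {i : ℕ}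
    (h1 : 1 ≤ i) (hi : i ≤ M) : ∃ k, IsClosest M x i k := by
  obtain ⟨m₀, hm₀⟩ := hx.exists_mem i h1 hi
  -- Local finiteness reduces the minimum to a finite set; the `+ 1` keeps `m₀` itself in this set.
  have hfin : {m | x m ∈ sector M i ∧ ‖x m‖ < ‖x m₀‖ + 1}.Finite :=
    (hx.finite (‖x m₀‖ + 1)).subset fun m hm => hm.2
  obtain ⟨k, hk, hmin⟩ := hfin.exists_minimalFor (fun m => ‖x m‖) _ ⟨m₀, hm₀, by simp⟩
  have hle : ∀ m, x m ∈ sector M i → ‖x k‖ ≤ ‖x m‖ := by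
    intro m hm
    rcases lt_or_ge (‖x m‖) (‖x m₀‖ + 1) with h | h
    · rcases le_total ‖x k‖ ‖x m‖ with h' | h'
      · exact h'
      · exact hmin ⟨hm, h⟩ h'
    · exact hk.2.le.trans h
  refine ⟨k, hk.1, fun m hm hne => lt_of_le_of_ne (hle m hm) fun heq => hne ?_⟩
  exact (hx.norm_inj i k m h1 hi hk.1 hm heq).symm

section Best

variable {l : ℝ → ℝ} {RC : ℝ} {M : ℕ} {x : ℕ → ℂ} {i k : ℕ}

/-- Monotonicity of `l` makes the closest station at least as good as any other; where `l` is
constant the tie rule of `IsBest` decides in its favour. -/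
lemma IsClosest.isBest_iff (hl : IsPathLoss l RC) (hk : IsClosest M x i k) (m : ℕ) :
    IsBest l M x i m ↔ m = k := by
  constructor
  · rintro ⟨hm, hbest⟩
    by_contra hne
    have hlt := hk.2 m hm hne
    have hll := hl.mono (norm_nonneg (x k)) (norm_nonneg (x m)) hlt.le
    rcases hbest k hk.1 with h | h
    · exact absurd hll (not_le.2 h)
    · exact absurd h.2 (not_le.2 hlt)
  · rintro rfl
    refine ⟨hk.1, fun m' hm' => ?_⟩
    rcases eq_or_ne m' m with rfl | hne
    · exact Or.inr ⟨rfl, le_rfl⟩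
    · have hlt := hk.2 m' hm' hne
      rcases (hl.mono (norm_nonneg (x m)) (norm_nonneg (x m')) hlt.le).lt_or_eq with h | h
      · exact Or.inl h
      · exact Or.inr ⟨h, hlt.le⟩

open Classical in
/-- The exponent `s ∈ [0, ∞]` for which the detection probability is `exp (-s)`. -/
noncomputable def detectExponent (l : ℝ → ℝ) (M : ℕ) (Γ Pw W : ℝ) (x : ℕ → ℂ) (i k : ℕ) : ℝ≥0∞ :=
  ENNReal.ofReal (W * Γ * l ‖x k‖ / (Pw * M)) +
    ∑' m, if x m ∈ sector M i ∧ m ≠ k then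
      ENNReal.ofReal (Real.log (1 + Γ * l ‖x k‖ / l ‖x m‖)) else 0

variable {Γ Pw W : ℝ}

lemma IsClosest.detectProb_eq (hl : IsPathLoss l RC) (hk : IsClosest M x i k)
    (hΓ : 0 < Γ) (hPw : 0 < Pw) (hW : 0 ≤ W) :
    detectProb l M Γ Pw W x i = (nexp (detectExponent l M Γ Pw W x i k)).toReal := by
  classical
  have hex : ∃ k, IsBest l M x i k := ⟨k, (hk.isBest_iff hl k).2 rfl⟩
  have hlk := hl.nonneg _ (norm_nonneg (x k))
  rw [detectProb, dif_pos hex, (hk.isBest_iff hl _).1 (Nat.find_spec hex), detectProbAt,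
    detectExponent, nexp_add, ENNReal.toReal_mul, nexp_ofReal (by positivity),
    ENNReal.toReal_ofReal (by positivity), ← (hasProd_toReal_nexp _).tprod_eq]
  congr 2
  funext m
  have hlm := hl.nonneg _ (norm_nonneg (x m))
  split_ifs
  · rw [nexp_log_one_add (by positivity), ENNReal.toReal_ofReal (by positivity)]
  · simp

open Classical in
/-- The coefficient of the fading variable of base station `m` in the condition for the detection
of base station `k`. -/
noncomputable def interfCoeff (l : ℝ → ℝ) (M : ℕ) (Γ : ℝ) (x : ℕ → ℂ) (i k m : ℕ) : ℝ :=
  if x m ∈ sector M i ∧ m ≠ k then Γ * l ‖x k‖ / l ‖x m‖ else 0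

lemma interfCoeff_nonneg (hl : IsPathLoss l RC) (hΓ : 0 < Γ) (m : ℕ) :
    0 ≤ interfCoeff l M Γ x i k m := by
  have h1 := hl.nonneg _ (norm_nonneg (x k))
  have h2 := hl.nonneg _ (norm_nonneg (x m))
  unfold interfCoeff
  split_ifs <;> positivity

/-- Clearing denominators makes detection linear in the fading variables, with the station's own
fading alone on the right. -/
lemma lt_sinr_iff (hl : IsPathLoss l RC) (hpos : ∀ m, 0 < ‖x m‖) (hM : 1 ≤ M)
    (hΓ : 0 < Γ) (f : ℕ → ℝ) :
    ENNReal.ofReal Γ < sinr l M Pw W x f i k ↔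
      ENNReal.ofReal (W * Γ * l ‖x k‖ / (Pw * M)) +
        ∑' m, ENNReal.ofReal (interfCoeff l M Γ x i k m) * ENNReal.ofReal (f m) <
      ENNReal.ofReal (f k) := by
  classical
  have hlk := hl.pos _ (hpos k)
  have hM' : (0 : ℝ) < M := by exact_mod_cast hM
  have hd : ENNReal.ofReal (W * Γ * l ‖x k‖ / (Pw * M)) +
        ∑' m, ENNReal.ofReal (interfCoeff l M Γ x i k m) * ENNReal.ofReal (f m) =
      ENNReal.ofReal (l ‖x k‖) * (ENNReal.ofReal Γ *
        (interference l M x f i k + ENNReal.ofReal (W / (Pw * M)))) := by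
    rw [interference, mul_add, mul_add, ← ENNReal.ofReal_mul hΓ.le, ← ENNReal.ofReal_mul hlk.le,
      add_comm]
    congr 1
    · rw [← ENNReal.tsum_mul_left, ← ENNReal.tsum_mul_left]
      refine tsum_congr fun m => ?_
      unfold interfCoeff
      have hlm := hl.pos _ (hpos m)
      split_ifs
      · rw [← ENNReal.ofReal_mul hΓ.le, ← ENNReal.ofReal_mul hlk.le,
          ← ENNReal.ofReal_mul (by positivity)]
        congr 1
        ring
      · simp
    · congr 1
      ring
  rw [hd, sinr]
  set d := interference l M x f i k + ENNReal.ofReal (W / (Pw * M))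
  have hlk0 : ENNReal.ofReal (l ‖x k‖) ≠ 0 := by simpa using hlk
  have hf : ENNReal.ofReal (f k) =
      ENNReal.ofReal (l ‖x k‖) * ENNReal.ofReal (f k / l ‖x k‖) := by
    rw [← ENNReal.ofReal_mul hlk.le, mul_div_cancel₀ _ hlk.ne']
  rw [hf, ENNReal.mul_lt_mul_iff_right hlk0 ENNReal.ofReal_ne_top]
  -- Since the threshold is neither `0` nor `∞`, the denominator `d` may be either of them.
  exact ENNReal.lt_div_iff_mul_lt (Or.inr ENNReal.ofReal_ne_top)
    (Or.inr (by simpa using hΓ))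

end Best

/-! ### Measurability -/

lemma angle_eq (z : ℂ) :
    angle z = if 0 ≤ Complex.arg z then Complex.arg z else Complex.arg z + 2 * Real.pi := by
  have h1 := Complex.neg_pi_lt_arg z
  have h2 := Complex.arg_le_pi z
  have hπ := Real.pi_pos
  unfold angle
  split_ifs with h
  · rw [toIcoMod_eq_self]
    constructor <;> linarith
  · push Not at h
    rw [← toIcoMod_add_right, toIcoMod_eq_self]
    constructor <;> linarith

lemma measurable_angle : Measurable angle := by
  rw [funext angle_eq]
  exact Measurable.ite (measurableSet_le measurable_const Complex.measurable_arg)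
    Complex.measurable_arg (Complex.measurable_arg.add_const _)

lemma measurableSet_sector (M i : ℕ) : MeasurableSet (sector M i) :=
  measurable_angle measurableSet_Ico

lemma disjoint_sector {M i j : ℕ} (hM : 1 ≤ M) (hij : i ≠ j) :
    Disjoint (sector M i) (sector M j) := by
  have hM' : (0 : ℝ) < M := by exact_mod_cast hM
  have key : ∀ {i j : ℕ}, i < j → Disjoint (sector M i) (sector M j) := by
    intro i j h
    rw [Set.disjoint_left]
    rintro z ⟨_, h1⟩ ⟨h2, _⟩
    have h3 : (i : ℝ) ≤ (j : ℝ) - 1 := by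
      have : (i : ℝ) + 1 ≤ j := by exact_mod_cast h
      linarith
    have : 2 * Real.pi * (i : ℝ) / M ≤ 2 * Real.pi * ((j : ℝ) - 1) / M := by
      have := Real.pi_pos
      gcongr
    linarith
  rcases lt_or_gt_of_ne hij with h | h
  · exact key h
  · exact (key h).symm

lemma measurableSet_isBest {l : ℝ → ℝ} (hl : Measurable l) (M i k : ℕ) :
    MeasurableSet {x : ℕ → ℂ | IsBest l M x i k} := by
  have hs : ∀ m, MeasurableSet {x : ℕ → ℂ | x m ∈ sector M i} := fun m =>
    measurable_pi_apply m (measurableSet_sector M i)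
  have hl' : ∀ m, Measurable fun x : ℕ → ℂ => l ‖x m‖ := fun m => by fun_prop
  have hn : ∀ m, Measurable fun x : ℕ → ℂ => ‖x m‖ := fun m => by fun_prop
  refine (hs k).inter (MeasurableSet.iInter fun m => ?_ :
    MeasurableSet (⋂ m, {x : ℕ → ℂ | x m ∈ sector M i →
      l ‖x k‖ < l ‖x m‖ ∨ (l ‖x k‖ = l ‖x m‖ ∧ ‖x k‖ ≤ ‖x m‖)})) |>.congr ?_
  · exact (hs m).imp ((measurableSet_lt (hl' k) (hl' m)).union
      ((measurableSet_eq_fun (hl' k) (hl' m)).inter (measurableSet_le (hn k) (hn m))))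
  · ext x
    simp [IsBest]

lemma measurable_sinr {l : ℝ → ℝ} (hl : Measurable l) (M : ℕ) (Pw W : ℝ) (i k : ℕ) :
    Measurable fun p : (ℕ → ℂ) × (ℕ → ℝ) => sinr l M Pw W p.1 p.2 i k := by
  classical
  have hl' : ∀ m, Measurable fun p : (ℕ → ℂ) × (ℕ → ℝ) => l ‖p.1 m‖ := fun m => by fun_prop
  have hf : ∀ m, Measurable fun p : (ℕ → ℂ) × (ℕ → ℝ) => p.2 m := fun m => by fun_prop
  have hx : ∀ m, Measurable fun p : (ℕ → ℂ) × (ℕ → ℝ) => p.1 m := fun m => by fun_prop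
  unfold sinr interference
  refine (((hf k).div (hl' k)).ennreal_ofReal).div (Measurable.add_const ?_ _)
  refine Measurable.tsum fun m => Measurable.ite ?_
    ((hf m).div (hl' m)).ennreal_ofReal measurable_const
  exact ((hx m) (measurableSet_sector M i)).inter (MeasurableSet.const _)

lemma measurableSet_sectorDetected {l : ℝ → ℝ} (hl : Measurable l) (M : ℕ) (Γ Pw W : ℝ) (i : ℕ) :
    MeasurableSet {p : (ℕ → ℂ) × (ℕ → ℝ) | SectorDetected l M Γ Pw W p.1 p.2 i} := by
  have e : {p : (ℕ → ℂ) × (ℕ → ℝ) | SectorDetected l M Γ Pw W p.1 p.2 i} =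
      ⋃ k, {p | IsBest l M p.1 i k} ∩ {p | ENNReal.ofReal Γ < sinr l M Pw W p.1 p.2 i k} := by
    ext p
    simp [SectorDetected]
  rw [e]
  exact MeasurableSet.iUnion fun k => (measurable_fst (measurableSet_isBest hl M i k)).inter
    (measurableSet_lt measurable_const (measurable_sinr hl M Pw W i k))

lemma measurableSet_cycleSuccess {l : ℝ → ℝ} (hl : Measurable l) (M : ℕ) (Γ Pw W : ℝ) :
    MeasurableSet {p : (ℕ → ℂ) × (ℕ → ℝ) | CycleSuccess l M Γ Pw W p.1 p.2} := by
  have e : {p : (ℕ → ℂ) × (ℕ → ℝ) | CycleSuccess l M Γ Pw W p.1 p.2} =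
      ⋃ i ∈ Finset.Icc 1 M, {p | SectorDetected l M Γ Pw W p.1 p.2 i} := by
    ext p
    simp [CycleSuccess, and_assoc]
  rw [e]
  exact Finset.measurableSet_biUnion _ fun i _ => measurableSet_sectorDetected hl M Γ Pw W i

/-- If the first success is in cycle `N`, exactly `j = 0, …, N - 1` are counted (`j = 0` imposes no
condition); without success every `j` counts and the sum is `∞`. -/
lemma numCycles_eq_tsum (l : ℝ → ℝ) (M : ℕ) (Γ Pw W : ℝ) (x : ℕ → ℂ) (f : ℕ → ℕ → ℝ) :
    numCycles l M Γ Pw W x f =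
      ∑' j : ℕ,
        {j : ℕ | ∀ n ∈ Finset.Icc 1 j, ¬ CycleSuccess l M Γ Pw W x (f n)}.indicator 1 j := by
  classical
  unfold numCycles
  by_cases h : ∃ n, 1 ≤ n ∧ CycleSuccess l M Γ Pw W x (f n)
  · have hs := Nat.find_spec h
    have hmin : ∀ j, (∀ n ∈ Finset.Icc 1 j, ¬ CycleSuccess l M Γ Pw W x (f n)) ↔
        j < Nat.find h := by
      intro j
      constructor
      · intro hj
        by_contra hlt
        exact hj _ (Finset.mem_Icc.2 ⟨hs.1, not_lt.1 hlt⟩) hs.2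
      · intro hj n hn hc
        rw [Finset.mem_Icc] at hn
        exact Nat.find_min h (hn.2.trans_lt hj) ⟨hn.1, hc⟩
    have e : {j : ℕ | ∀ n ∈ Finset.Icc 1 j, ¬ CycleSuccess l M Γ Pw W x (f n)} =
        (Finset.range (Nat.find h) : Set ℕ) := by
      ext j
      rw [mem_ofPred_eq, hmin]
      simp
    rw [e, ← tsum_subtype, Finset.tsum_subtype']
    simp only [Pi.one_apply, Finset.sum_const, Finset.card_range, nsmul_eq_mul, mul_one]
    refine le_antisymm (iInf_le_of_le _ (iInf_le _ hs)) (le_iInf₂ fun n hn => ?_)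
    exact_mod_cast Nat.find_min' h hn
  · have e : {j : ℕ | ∀ n ∈ Finset.Icc 1 j, ¬ CycleSuccess l M Γ Pw W x (f n)} = univ := by
      ext j
      simp only [mem_ofPred_eq, mem_univ, iff_true, Finset.mem_Icc]
      exact fun n hn hc => h ⟨n, hn.1, hc⟩
    rw [e, indicator_univ]
    simp only [Pi.one_apply, ENNReal.tsum_const_eq_top_of_ne_zero one_ne_zero]
    refine iInf_eq_top.2 fun n => iInf_eq_top.2 fun hn => ?_
    exact absurd ⟨n, hn⟩ h

/-! ### The success probabilities for a given configuration -/

section Conditional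

variable {Ω : Type*} [MeasurableSpace Ω] {μ : Measure Ω} [IsProbabilityMeasure μ]
variable {l : ℝ → ℝ} {RC : ℝ} {M : ℕ} {x : ℕ → ℂ} {i k : ℕ} {Γ Pw W : ℝ}

lemma measure_sectorDetected (hl : IsPathLoss l RC) (hx : IsRegular M RC x)
    (hk : IsClosest M x i k) (hM : 1 ≤ M) (hΓ : 0 < Γ)
    {F : ℕ → Ω → ℝ} (hF : ∀ m, Measurable (F m)) (hlaw : ∀ m, μ.map (F m) = expMeasure 1)
    (hind : iIndepFun F μ) :
    μ {ω | SectorDetected l M Γ Pw W x (fun m => F m ω) i} =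
      nexp (detectExponent l M Γ Pw W x i k) := by
  classical
  set c := ENNReal.ofReal (W * Γ * l ‖x k‖ / (Pw * M))
  set s := interfCoeff l M Γ x i k with hs
  have hs0 : ∀ m, 0 ≤ s m := interfCoeff_nonneg hl hΓ
  set Y : Ω → ℝ≥0∞ := fun ω => c + ∑' m, ENNReal.ofReal (s m) * ENNReal.ofReal (F m ω)
  have hYm : Measurable Y := by fun_prop
  have e : {ω | SectorDetected l M Γ Pw W x (fun m => F m ω) i} =
      {ω | Y ω < ENNReal.ofReal (F k ω)} := by
    ext ω
    simp only [mem_ofPred_eq, SectorDetected, hk.isBest_iff hl, exists_eq_left]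
    exact lt_sinr_iff hl hx.norm_pos hM hΓ _
  -- The coefficient of `F k` in `Y` is `0`, so `Y` is a function of the block `S false` of all
  -- indices other than `k`, while `S true` is `{k}`. In `g` the absent coordinate `k` is filled
  -- with `0`.
  have hYF : IndepFun Y (F k) μ := by
    let S : Bool → Set ℕ := fun b => {m | m = k ↔ b = true}
    have hb := iIndepFun_blocks hF hind S (by
      intro a b hab
      rw [Set.disjoint_left]
      intro m h1 h2
      simp only [S, mem_ofPred_eq] at h1 h2
      exact hab (Bool.eq_iff_iff.2 (h1.symm.trans h2)))
    have hb' := hb.indepFun (i := false) (j := true) (by simp)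
    let g : (S false → ℝ) → ℝ≥0∞ := fun y =>
      c + ∑' m, ENNReal.ofReal (s m) *
        ENNReal.ofReal (if h : m = k then 0 else y ⟨m, by simpa [S] using h⟩)
    have hg : Measurable g := by
      refine Measurable.const_add (Measurable.tsum fun m => ?_) _
      by_cases h : m = k
      · simp only [h, dite_true]
        fun_prop
      · simp only [h, dite_false]
        fun_prop
    have h2 := hb'.comp hg (measurable_pi_apply (⟨k, by simp [S]⟩ : S true))
    have hY : Y = g ∘ fun ω (j : S false) => F j ω := by
      funext ω
      simp only [Y, g, Function.comp]
      congr 2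
      funext m
      by_cases h : m = k
      · have : s m = 0 := by simp [hs, interfCoeff, h]
        simp [this]
      · simp [h]
    rw [hY]
    exact h2
  rw [e, measure_lt_ofReal_of_indepFun (hF k) hYm (hlaw k) hYF]
  simp only [Y, nexp_add]
  rw [lintegral_const_mul _ (by fun_prop), lintegral_nexp_tsum_exponential hF hlaw hind hs0,
    detectExponent, nexp_add]
  congr 3
  funext m
  simp only [hs, interfCoeff]
  split_ifs <;> simp

/-- Detection reads only the fading of the stations in the sector, hence it is an event of one block
of variables. -/
lemma sectorDetected_congr {f g : ℕ → ℝ} (hfg : ∀ m, x m ∈ sector M i → f m = g m) :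
    SectorDetected l M Γ Pw W x f i ↔ SectorDetected l M Γ Pw W x g i := by
  classical
  refine exists_congr fun k => and_congr_right fun hk => ?_
  have h1 : interference l M x f i k = interference l M x g i k := by
    refine tsum_congr fun m => ?_
    split_ifs with h
    · rw [hfg m h.1]
    · rfl
  rw [sinr, sinr, h1, hfg k hk.1]

lemma measure_forall_not_cycleSuccess (hl : IsPathLoss l RC) (hx : IsRegular M RC x)
    (hM : 1 ≤ M) (hΓ : 0 < Γ) (hPw : 0 < Pw) (hW : 0 ≤ W)
    {F : ℕ → ℕ → Ω → ℝ} (hF : ∀ n m, Measurable (F n m))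
    (hlaw : ∀ n m, μ.map (F n m) = expMeasure 1)
    (hind : iIndepFun (fun (p : ℕ × ℕ) => F p.1 p.2) μ) (j : ℕ) :
    μ {ω | ∀ n ∈ Finset.Icc 1 j, ¬ CycleSuccess l M Γ Pw W x (fun m => F n m ω)} =
      ENNReal.ofReal (∏ i ∈ Finset.Icc 1 M, (1 - detectProb l M Γ Pw W x i) ^ j) := by
  classical
  -- For `a` = (cycle, sector), `S a` indexes the fading variables which that detection event
  -- depends on. Disjoint sectors make these blocks disjoint.
  let S : ℕ × ℕ → Set (ℕ × ℕ) := fun a => {p | p.1 = a.1 ∧ x p.2 ∈ sector M a.2}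
  have hS : Pairwise fun a b => Disjoint (S a) (S b) := by
    intro a b hab
    rw [Set.disjoint_left]
    rintro p ⟨h1, h2⟩ ⟨h3, h4⟩
    refine hab (Prod.ext (h1.symm.trans h3) ?_)
    by_contra hne
    exact Set.disjoint_left.1 (disjoint_sector hM hne) h2 h4
  have hb := iIndepFun_blocks (X := fun p : ℕ × ℕ => F p.1 p.2) (fun p => hF _ _) hind S hS
  -- Extension by `0` outside the sector, harmless by `sectorDetected_congr`.
  let ext (a : ℕ × ℕ) (y : S a → ℝ) : ℕ → ℝ :=
    fun m => if h : x m ∈ sector M a.2 then y ⟨(a.1, m), rfl, h⟩ else 0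
  have hext : ∀ a, Measurable (ext a) := by
    intro a
    refine measurable_pi_lambda _ fun m => ?_
    by_cases h : x m ∈ sector M a.2
    · simp only [ext, h, dif_pos]
      fun_prop
    · simp only [ext, h, dif_neg, not_false_eq_true]
      fun_prop
  have hmeasx : ∀ i, MeasurableSet {f : ℕ → ℝ | SectorDetected l M Γ Pw W x f i} := fun i =>
    (measurable_const.prodMk measurable_id : Measurable fun f : ℕ → ℝ => (x, f))
      (measurableSet_sectorDetected hl.measurable M Γ Pw W i)
  let B (a : ℕ × ℕ) : Set (S a → ℝ) := {y | ¬ SectorDetected l M Γ Pw W x (ext a y) a.2}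
  have hB : ∀ a, MeasurableSet (B a) := fun a => (hext a (hmeasx a.2)).compl
  have hpre : ∀ a : ℕ × ℕ, (fun ω (p : S a) => F p.1.1 p.1.2 ω) ⁻¹' (B a) =
      {ω | SectorDetected l M Γ Pw W x (fun m => F a.1 m ω) a.2}ᶜ := by
    intro a
    ext ω
    simp only [B, mem_preimage, mem_ofPred_eq, mem_compl_iff]
    rw [not_iff_not]
    refine sectorDetected_congr fun m hm => ?_
    simp [ext, hm]
  have e : {ω | ∀ n ∈ Finset.Icc 1 j, ¬ CycleSuccess l M Γ Pw W x (fun m => F n m ω)} =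
      ⋂ a ∈ Finset.Icc 1 j ×ˢ Finset.Icc 1 M,
        (fun ω (p : S a) => F p.1.1 p.1.2 ω) ⁻¹' (B a) := by
    ext ω
    simp only [hpre, mem_iInter, CycleSuccess, mem_ofPred_eq, mem_compl_iff, Finset.mem_product,
      Finset.mem_Icc, Prod.forall]
    exact ⟨fun h n i hni hd => h n hni.1 ⟨i, hni.2.1, hni.2.2, hd⟩,
      fun h n hn ⟨i, h1, h2, hd⟩ => h n i ⟨hn, h1, h2⟩ hd⟩
  rw [e, hb.measure_inter_preimage_eq_mul _ fun a _ => hB a, Finset.prod_product]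
  have hfac : ∀ n, ∀ i ∈ Finset.Icc 1 M,
      μ ((fun ω (p : S (n, i)) => F p.1.1 p.1.2 ω) ⁻¹' (B (n, i))) =
        ENNReal.ofReal (1 - detectProb l M Γ Pw W x i) := by
    intro n i hi
    rw [Finset.mem_Icc] at hi
    obtain ⟨k, hk⟩ := hx.exists_isClosest hi.1 hi.2
    have hmeas : MeasurableSet {ω | SectorDetected l M Γ Pw W x (fun m => F n m ω) i} :=
      (measurable_pi_lambda _ fun m => hF n m : Measurable fun ω m => F n m ω) (hmeasx i)
    rw [hpre, measure_compl hmeas (measure_ne_top _ _), measure_univ,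
      measure_sectorDetected hl hx hk hM hΓ (hF n) (hlaw n)
        (hind.precomp (g := fun m => (n, m)) (Prod.mk_right_injective n)),
      hk.detectProb_eq hl hΓ hPw hW, ENNReal.ofReal_sub _ ENNReal.toReal_nonneg,
      ENNReal.ofReal_toReal (nexp_ne_top _), ENNReal.ofReal_one]
  have hp1 : ∀ i ∈ Finset.Icc 1 M, 0 ≤ 1 - detectProb l M Γ Pw W x i := by
    intro i hi
    rw [Finset.mem_Icc] at hi
    obtain ⟨k, hk⟩ := hx.exists_isClosest hi.1 hi.2
    rw [hk.detectProb_eq hl hΓ hPw hW]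
    linarith [toReal_nexp_le_one (detectExponent l M Γ Pw W x i k)]
  rw [Finset.prod_congr rfl fun n _ => Finset.prod_congr rfl (hfac n), Finset.prod_const,
    Nat.card_Icc, Nat.add_sub_cancel, Finset.prod_pow, ENNReal.ofReal_pow (Finset.prod_nonneg hp1),
    ENNReal.ofReal_prod_of_nonneg hp1]

end Conditional

/-! ### Areas of sectors of annuli -/

/-- Polar coordinates use angles in `(-π, π)`, sectors use `[0, 2π)`. The interval is cut at `π` and
its upper part shifted by `2π`; the lost angle `π` is a null set. -/
lemma volume_angle_Ico {a b : ℝ} (ha : 0 ≤ a) (hb : b ≤ 2 * Real.pi) :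
    volume ({θ : ℝ | (if 0 ≤ θ then θ else θ + 2 * Real.pi) ∈ Ico a b} ∩
      Ioo (-Real.pi) Real.pi) = ENNReal.ofReal (b - a) := by
  have hπ := Real.pi_pos
  have e : {θ : ℝ | (if 0 ≤ θ then θ else θ + 2 * Real.pi) ∈ Ico a b} ∩
      Ioo (-Real.pi) Real.pi = (Ico a b ∩ Iio Real.pi) ∪
        (fun θ => θ + 2 * Real.pi) ⁻¹' (Ico a b ∩ Ioi Real.pi) := by
    ext θ
    simp only [mem_inter_iff, mem_ofPred_eq, mem_union, mem_preimage, mem_Ico, mem_Ioo, mem_Iio,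
      mem_Ioi]
    split_ifs with h
    · constructor
      · rintro ⟨h1, h2⟩
        exact Or.inl ⟨h1, h2.2⟩
      · rintro (⟨h1, h2⟩ | ⟨h1, h2⟩)
        · exact ⟨h1, by linarith, h2⟩
        · linarith [h1.2]
    · push Not at h
      constructor
      · rintro ⟨h1, h2⟩
        exact Or.inr ⟨h1, by linarith⟩
      · rintro (⟨h1, h2⟩ | ⟨h1, h2⟩)
        · linarith [h1.1]
        · exact ⟨h1, by linarith, by linarith⟩
  have hd : Disjoint (Ico a b ∩ Iio Real.pi)
      ((fun θ => θ + 2 * Real.pi) ⁻¹' (Ico a b ∩ Ioi Real.pi)) := by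
    rw [Set.disjoint_left]
    rintro θ ⟨⟨h1, h2⟩, h3⟩ ⟨⟨h4, h5⟩, h6⟩
    simp only [mem_Iio] at h3
    linarith
  rw [e, measure_union hd (by measurability), measure_preimage_add_right, ← Real.volume_Ico,
    ← measure_inter_add_sdiff (Ico a b) (measurableSet_Iio (a := Real.pi))]
  congr 1
  have h2 : Ico a b \ Iio Real.pi = Ico a b ∩ Ici Real.pi := by
    ext θ; simp
  rw [h2]
  exact measure_congr ((ae_eq_refl _).inter Ioi_ae_eq_Ici)

lemma volume_sector_inter {M i : ℕ} (h1 : 1 ≤ i) (hi : i ≤ M) {A : Set ℝ}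
    (hA : MeasurableSet A) :
    volume (sector M i ∩ (fun z : ℂ => ‖z‖) ⁻¹' A) =
      ENNReal.ofReal (2 * Real.pi / M) *
        ∫⁻ r in Ioi 0, A.indicator (fun r => ENNReal.ofReal r) r := by
  have hM' : (0 : ℝ) < M := by exact_mod_cast h1.trans hi
  have hπ := Real.pi_pos
  have h1' : (1 : ℝ) ≤ i := by exact_mod_cast h1
  have hi' : (i : ℝ) ≤ M := by exact_mod_cast hi
  set a : ℝ := 2 * Real.pi * ((i : ℝ) - 1) / M
  set b : ℝ := 2 * Real.pi * (i : ℝ) / M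
  have ha : 0 ≤ a := div_nonneg (by nlinarith) hM'.le
  have hb : b ≤ 2 * Real.pi := by
    rw [div_le_iff₀ hM']
    gcongr
  have hab : b - a = 2 * Real.pi / M := by
    simp only [a, b]
    ring
  set T := {θ : ℝ | (if 0 ≤ θ then θ else θ + 2 * Real.pi) ∈ Ico a b} with hT
  have hTm : MeasurableSet T := by
    refine (Measurable.ite (measurableSet_le measurable_const measurable_id) measurable_id
      (measurable_id.add_const _) : Measurable fun θ : ℝ => if 0 ≤ θ then θ else θ + 2 * Real.pi)
      measurableSet_Ico
  have hm : MeasurableSet (sector M i ∩ (fun z : ℂ => ‖z‖) ⁻¹' A) :=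
    (measurableSet_sector M i).inter (measurable_norm hA)
  rw [← lintegral_indicator_one hm, ← Complex.lintegral_comp_polarCoord_symm]
  -- In polar coordinates the indicator, with the Jacobian, splits into a radial times an angular
  -- factor.
  have e : ∀ p ∈ polarCoord.target, ENNReal.ofReal p.1 •
      (sector M i ∩ (fun z : ℂ => ‖z‖) ⁻¹' A).indicator (1 : ℂ → ℝ≥0∞)
        (Complex.polarCoord.symm p) =
      A.indicator (fun r => ENNReal.ofReal r) p.1 * T.indicator 1 p.2 := by
    rintro ⟨r, θ⟩ ⟨hr, hθ⟩
    simp only [mem_Ioi] at hr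
    have hn : ‖Complex.polarCoord.symm (r, θ)‖ = r := by
      rw [Complex.norm_polarCoord_symm, abs_of_pos hr]
    have harg : Complex.arg (Complex.polarCoord.symm (r, θ)) = θ := by
      rw [Complex.polarCoord_symm_apply]
      exact_mod_cast Complex.arg_mul_cos_add_sin_mul_I hr ⟨hθ.1, hθ.2.le⟩
    have hsec : Complex.polarCoord.symm (r, θ) ∈ sector M i ↔ θ ∈ T := by
      rw [sector, mem_ofPred_eq, angle_eq, harg]
      rfl
    classical
    simp only [indicator_apply, mem_inter_iff, mem_preimage, hn, hsec]
    by_cases h3 : θ ∈ T <;> by_cases h4 : r ∈ A <;> simp [h3, h4]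
  rw [setLIntegral_congr_fun polarCoord.open_target.measurableSet e, polarCoord_target,
    Measure.volume_eq_prod, ← Measure.prod_restrict,
    lintegral_prod_mul ((Measurable.indicator (by fun_prop) hA).aemeasurable)
      ((measurable_one.indicator hTm).aemeasurable),
    lintegral_indicator_one hTm, Measure.restrict_apply hTm, hT, volume_angle_Ico ha hb, hab,
    mul_comm]

lemma lintegral_Ioi_indicator_Ico {a b : ℝ} (ha : 0 ≤ a) (hab : a ≤ b) :
    ∫⁻ r in Ioi 0, (Ico a b).indicator (fun r => ENNReal.ofReal r) r =
      ENNReal.ofReal ((b ^ 2 - a ^ 2) / 2) := by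
  rw [lintegral_indicator measurableSet_Ico, Measure.restrict_restrict measurableSet_Ico]
  have h1 : (Ico a b ∩ Ioi 0 : Set ℝ) =ᵐ[volume] Ioc a b := by
    have : (Ico a b ∩ Ioi 0 : Set ℝ) =ᵐ[volume] (Ico a b ∩ Ici 0 : Set ℝ) :=
      (ae_eq_refl _).inter Ioi_ae_eq_Ici
    refine this.trans ?_
    have e : (Ico a b ∩ Ici 0 : Set ℝ) = Ico a b :=
      inter_eq_left.2 fun r hr => ha.trans hr.1
    rw [e]
    exact Ico_ae_eq_Ioc
  rw [setLIntegral_congr h1, ← ofReal_integral_eq_lintegral_ofReal, ← integral_id,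
    intervalIntegral.integral_of_le hab]
  · exact (continuous_id.integrableOn_Icc).mono_set Ioc_subset_Icc_self
  · refine (ae_restrict_iff' measurableSet_Ioc).2 (Eventually.of_forall fun r hr => ?_)
    exact ha.trans hr.1.le

lemma volume_sector_annulus {M i : ℕ} (h1 : 1 ≤ i) (hi : i ≤ M) {a b : ℝ} (ha : 0 ≤ a)
    (hab : a ≤ b) :
    volume (sector M i ∩ (fun z : ℂ => ‖z‖) ⁻¹' (Ico a b)) =
      ENNReal.ofReal (Real.pi / M * (b ^ 2 - a ^ 2)) := by
  have hπ := Real.pi_pos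
  rw [volume_sector_inter h1 hi measurableSet_Ico, lintegral_Ioi_indicator_Ico ha hab,
    ← ENNReal.ofReal_mul (by positivity)]
  congr 1
  ring

/-! ### Counts of a Poisson process -/

section Counts

variable {Ω : Type*} [MeasurableSpace Ω] {μ : Measure Ω} {X : ℕ → Ω → ℂ} {lam : ℝ}

lemma measurable_pointCount (hX : ∀ n, Measurable (X n)) {B : Set ℂ} (hB : MeasurableSet B) :
    Measurable fun ω => pointCount (fun n => X n ω) B :=
  Measurable.tsum fun n => (measurable_one.indicator hB).comp (hX n)

lemma two_le_pointCount {x : ℕ → ℂ} {B : Set ℂ} {m m' : ℕ} (hne : m ≠ m') (hm : x m ∈ B)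
    (hm' : x m' ∈ B) : 2 ≤ pointCount x B := by
  calc (2 : ℝ≥0∞) = ∑ j ∈ {m, m'}, B.indicator 1 (x j) := by
        rw [Finset.sum_pair hne]
        simp [hm, hm', one_add_one_eq_two]
    _ ≤ _ := ENNReal.sum_le_tsum _

lemma pointCount_eq_zero_iff {x : ℕ → ℂ} {B : Set ℂ} : pointCount x B = 0 ↔ ∀ m, x m ∉ B := by
  simp [pointCount]

lemma finite_of_pointCount_ne_top {x : ℕ → ℂ} {B : Set ℂ} (h : pointCount x B ≠ ∞) :
    {m | x m ∈ B}.Finite := by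
  refine (ENNReal.finite_const_le_of_tsum_ne_top h one_ne_zero).subset fun m hm => ?_
  simp only [mem_ofPred_eq] at hm ⊢
  simp [hm]

namespace IsPoissonPointProcess

variable (hX : IsPoissonPointProcess X lam μ) {B : Set ℂ} (hB : MeasurableSet B)
  (hfin : volume B ≠ ∞)
include hX hB hfin

lemma measure_pointCount_mem {A : Set ℝ≥0∞} (hA : MeasurableSet A) :
    μ {ω | pointCount (fun n => X n ω) B ∈ A} =
      poissonMeasure (lam * (volume B).toReal).toNNReal {n : ℕ | (n : ℝ≥0∞) ∈ A} := by
  have h := congrArg (fun ν => ν A) (hX.law_count B hB hfin)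
  rwa [Measure.map_apply (measurable_pointCount hX.measurable_point hB) hA,
    Measure.map_apply measurable_from_top hA] at h

lemma lintegral_pointCount {g : ℝ≥0∞ → ℝ≥0∞} (hg : Measurable g) :
    ∫⁻ ω, g (pointCount (fun n => X n ω) B) ∂μ =
      ∫⁻ n : ℕ, g n ∂(poissonMeasure (lam * (volume B).toReal).toNNReal) := by
  rw [← lintegral_map hg (measurable_pointCount hX.measurable_point hB),
    hX.law_count B hB hfin, lintegral_map hg measurable_from_top]

lemma measure_pointCount_eq_zero (hlam : 0 ≤ lam) :
    μ {ω | pointCount (fun n => X n ω) B = 0} =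
      nexp (ENNReal.ofReal (lam * (volume B).toReal)) := by
  have h := hX.measure_pointCount_mem hB hfin (measurableSet_singleton (0 : ℝ≥0∞))
  have e : {n : ℕ | (n : ℝ≥0∞) ∈ ({0} : Set ℝ≥0∞)} = {0} := by ext; simp
  have h0 : 0 ≤ lam * (volume B).toReal := by positivity
  rw [e, poissonMeasure_singleton] at h
  rw [nexp_ofReal h0]
  simpa [Real.coe_toNNReal _ h0] using h

lemma measure_two_le_pointCount (hlam : 0 ≤ lam) :
    μ {ω | 2 ≤ pointCount (fun n => X n ω) B} ≤
      ENNReal.ofReal ((lam * (volume B).toReal) ^ 2) := by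
  have h0 : 0 ≤ lam * (volume B).toReal := by positivity
  refine (hX.measure_pointCount_mem hB hfin (measurableSet_Ici (a := 2))).le.trans ?_
  set r := (lam * (volume B).toReal).toNNReal
  have hr : lam * (volume B).toReal = r := (Real.coe_toNNReal _ h0).symm
  have e : {n : ℕ | (n : ℝ≥0∞) ∈ Ici (2 : ℝ≥0∞)} = (({0, 1} : Finset ℕ) : Set ℕ)ᶜ := by
    ext n
    have : ((2 : ℕ) : ℝ≥0∞) ≤ n ↔ 2 ≤ n := Nat.cast_le
    simp only [Nat.cast_ofNat] at this
    simp only [mem_Ici, mem_ofPred_eq, this, mem_compl_iff, Finset.mem_coe, Finset.mem_insert,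
      Finset.mem_singleton]
    omega
  rw [e, measure_compl (Finset.measurableSet _) (measure_ne_top _ _), measure_univ,
    ← sum_measure_singleton, Finset.sum_pair (by simp), poissonMeasure_singleton,
    poissonMeasure_singleton, ← ENNReal.ofReal_add (by positivity) (by positivity),
    ← ENNReal.ofReal_one, ← ENNReal.ofReal_sub _ (by positivity), hr]
  refine ENNReal.ofReal_le_ofReal ?_
  -- From `exp (-r) ≥ 1 - r` one gets `1 - exp (-r) * (1 + r) ≤ 1 - (1 - r) * (1 + r) = r ^ 2`.
  have h1 := Real.add_one_le_exp (-(r : ℝ))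
  have h2 : (0 : ℝ) ≤ r := r.coe_nonneg
  simp only [pow_zero, mul_one, Nat.factorial_zero, Nat.cast_one, div_one, pow_one,
    Nat.factorial_one]
  nlinarith

lemma ae_pointCount_ne_top : ∀ᵐ ω ∂μ, pointCount (fun n => X n ω) B ≠ ∞ := by
  have h := hX.measure_pointCount_mem hB hfin (measurableSet_singleton ∞)
  have e : {n : ℕ | (n : ℝ≥0∞) ∈ ({∞} : Set ℝ≥0∞)} = ∅ := by ext; simp
  rw [e, measure_empty] at h
  rw [ae_iff]
  simpa using h

lemma measure_forall_notMem (hlam : 0 ≤ lam) : μ {ω | ∀ m, X m ω ∉ B} =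
    nexp (ENNReal.ofReal (lam * (volume B).toReal)) := by
  simp only [← hX.measure_pointCount_eq_zero hB hfin hlam, pointCount_eq_zero_iff]

end IsPoissonPointProcess

lemma ae_notMem_of_volume_eq_zero [IsProbabilityMeasure μ]
    (hX : IsPoissonPointProcess X lam μ) {B : Set ℂ} (hB : MeasurableSet B) (h0 : volume B = 0)
    (hlam : 0 ≤ lam) : ∀ᵐ ω ∂μ, ∀ m, X m ω ∉ B := by
  have h := hX.measure_forall_notMem hB (by simp [h0]) hlam
  have hm : MeasurableSet {ω | ∀ m, X m ω ∉ B} := by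
    rw [ofPred_forall]
    exact MeasurableSet.iInter fun m => (hX.measurable_point m hB).compl
  rw [h0] at h
  rw [ae_iff, ← compl_ofPred, prob_compl_eq_zero_iff hm]
  simpa using h

end Counts

/-! ### Cells and regularity of Poisson configurations -/

/-- The part of sector `i` at distances in `[q / 2 ^ n, (q + 1) / 2 ^ n)`. -/
def cell (M i n q : ℕ) : Set ℂ := {z | z ∈ sector M i ∧ ⌊‖z‖ * 2 ^ n⌋₊ = q}

/-- The mean number of points in a cell. -/
noncomputable def cellRate (lam : ℝ) (M n q : ℕ) : ℝ :=
  lam * (Real.pi / M * (((q + 1 : ℝ) / 2 ^ n) ^ 2 - ((q : ℝ) / 2 ^ n) ^ 2))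

lemma floor_mul_eq_iff {r : ℝ} (hr : 0 ≤ r) (n q : ℕ) :
    ⌊r * 2 ^ n⌋₊ = q ↔ r ∈ Ico ((q : ℝ) / 2 ^ n) ((q + 1 : ℝ) / 2 ^ n) := by
  rw [Nat.floor_eq_iff (by positivity), mem_Ico, div_le_iff₀ (by positivity),
    lt_div_iff₀ (by positivity)]

lemma cell_eq (M i n q : ℕ) : cell M i n q =
    sector M i ∩ (fun z : ℂ => ‖z‖) ⁻¹' (Ico ((q : ℝ) / 2 ^ n) ((q + 1 : ℝ) / 2 ^ n)) := by
  ext z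
  simp only [cell, mem_ofPred_eq, floor_mul_eq_iff (norm_nonneg z), mem_inter_iff, mem_preimage]

lemma measurableSet_cell (M i n q : ℕ) : MeasurableSet (cell M i n q) := by
  rw [cell_eq]
  exact (measurableSet_sector M i).inter (measurable_norm measurableSet_Ico)

section Rate

variable {M i n q : ℕ} {lam : ℝ}

lemma volume_cell (h1 : 1 ≤ i) (hi : i ≤ M) : volume (cell M i n q) =
    ENNReal.ofReal (Real.pi / M * (((q + 1 : ℝ) / 2 ^ n) ^ 2 - ((q : ℝ) / 2 ^ n) ^ 2)) := by
  rw [cell_eq, volume_sector_annulus h1 hi (by positivity) (by gcongr; linarith)]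

lemma volume_cell_ne_top (h1 : 1 ≤ i) (hi : i ≤ M) : volume (cell M i n q) ≠ ∞ := by
  simp [volume_cell h1 hi]

lemma cellRate_nonneg (hlam : 0 ≤ lam) : 0 ≤ cellRate lam M n q := by
  have : ((q : ℝ) / 2 ^ n) ^ 2 ≤ ((q + 1 : ℝ) / 2 ^ n) ^ 2 := by gcongr; linarith
  have hπ := Real.pi_pos
  have := sub_nonneg.2 this
  unfold cellRate
  positivity

lemma mul_toReal_volume_cell (h1 : 1 ≤ i) (hi : i ≤ M) :
    lam * (volume (cell M i n q)).toReal = cellRate lam M n q := by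
  have : ((q : ℝ) / 2 ^ n) ^ 2 ≤ ((q + 1 : ℝ) / 2 ^ n) ^ 2 := by gcongr; linarith
  have hπ := Real.pi_pos
  have := sub_nonneg.2 this
  rw [volume_cell h1 hi, ENNReal.toReal_ofReal (by positivity), cellRate]

end Rate

section Regular

variable {Ω : Type*} [MeasurableSpace Ω] {μ : Measure Ω} {X : ℕ → Ω → ℂ} {lam : ℝ} {M : ℕ}

lemma ae_finite_norm_lt (hX : IsPoissonPointProcess X lam μ) :
    ∀ᵐ ω ∂μ, ∀ R : ℝ, {m | ‖X m ω‖ < R}.Finite := by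
  have h : ∀ᵐ ω ∂μ, ∀ R : ℕ, pointCount (fun n => X n ω) (Metric.ball 0 (R : ℝ)) ≠ ∞ :=
    ae_all_iff.2 fun R => hX.ae_pointCount_ne_top Metric.isOpen_ball.measurableSet
      Metric.isBounded_ball.measure_lt_top.ne
  filter_upwards [h] with ω hω R
  obtain ⟨N, hN⟩ := exists_nat_ge R
  refine (finite_of_pointCount_ne_top (hω N)).subset fun m hm => ?_
  simp only [mem_ofPred_eq, mem_ball_zero_iff] at hm ⊢
  exact hm.trans_le hN

/-- The sector has no point within distance `R` with probability `exp (-lam π R² / M)`, which tends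
to `0`. -/
lemma ae_exists_mem_sector (hX : IsPoissonPointProcess X lam μ) (hlam : 0 < lam) {i : ℕ}
    (h1 : 1 ≤ i) (hi : i ≤ M) : ∀ᵐ ω ∂μ, ∃ m, X m ω ∈ sector M i := by
  have hM' : (0 : ℝ) < M := by exact_mod_cast h1.trans hi
  have hπ := Real.pi_pos
  rw [ae_iff]
  refine le_antisymm (ge_of_tendsto' (x := atTop) (f := fun R : ℕ => nexp (ENNReal.ofReal (lam *
    (volume (sector M i ∩ (fun z : ℂ => ‖z‖) ⁻¹' (Ico 0 (R : ℝ)))).toReal))) ?_ fun R => ?_) bot_le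
  · rw [← nexp_top]
    refine (continuous_nexp.tendsto _).comp (ENNReal.tendsto_ofReal_atTop.comp ?_)
    have e : (fun R : ℕ => lam *
        (volume (sector M i ∩ (fun z : ℂ => ‖z‖) ⁻¹' (Ico 0 (R : ℝ)))).toReal) =
        fun R : ℕ => lam * (Real.pi / M) * (R : ℝ) ^ 2 := by
      funext R
      rw [volume_sector_annulus h1 hi le_rfl (Nat.cast_nonneg R),
        ENNReal.toReal_ofReal (by simp; positivity)]
      ring
    rw [e]
    exact ((tendsto_pow_atTop two_ne_zero).comp tendsto_natCast_atTop_atTop).const_mul_atTop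
      (by positivity)
  · rw [← hX.measure_forall_notMem ((measurableSet_sector M i).inter
      (measurable_norm measurableSet_Ico)) ?_ hlam.le]
    · refine measure_mono fun ω hω m hm => hω ⟨m, hm.1⟩
    · simp [volume_sector_annulus h1 hi le_rfl (Nat.cast_nonneg R)]

/-- Two stations at equal distance share a cell at every level `n`. Below radius `R` there are `R *
2 ^ n` cells, each containing two points with probability `O(4⁻ⁿ)`, so the union bound is `O(2⁻ⁿ)`.
-/
lemma ae_norm_injOn_sector (hX : IsPoissonPointProcess X lam μ) (hlam : 0 ≤ lam) {i : ℕ}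
    (h1 : 1 ≤ i) (hi : i ≤ M) : ∀ᵐ ω ∂μ, ∀ m m', X m ω ∈ sector M i → X m' ω ∈ sector M i →
      ‖X m ω‖ = ‖X m' ω‖ → m = m' := by
  have hM' : (0 : ℝ) < M := by exact_mod_cast h1.trans hi
  have hπ := Real.pi_pos
  have key : ∀ R : ℕ, ∀ᵐ ω ∂μ, ∀ m m', X m ω ∈ sector M i → X m' ω ∈ sector M i →
      ‖X m ω‖ < R → ‖X m ω‖ = ‖X m' ω‖ → m = m' := by
    intro R
    rw [ae_iff]
    -- Chosen so that the number `R * 2 ^ n` of cells times the squared bound `lam * (π / M) * (2 *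
    -- R) / 2 ^ n` on their rates is `C / 2 ^ n`.
    set C : ℝ := (R : ℝ) * (lam * (Real.pi / M) * (2 * R)) ^ 2
    refine le_antisymm (ge_of_tendsto' (x := atTop)
      (f := fun n : ℕ => ENNReal.ofReal (C * (1 / 2) ^ n)) ?_ fun n => ?_) bot_le
    · rw [← ENNReal.ofReal_zero, ← mul_zero C]
      refine ENNReal.tendsto_ofReal (Tendsto.const_mul C ?_)
      exact tendsto_pow_atTop_nhds_zero_of_lt_one (by norm_num) (by norm_num)
    · have hsub : {ω | ¬ ∀ m m', X m ω ∈ sector M i → X m' ω ∈ sector M i →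
          ‖X m ω‖ < R → ‖X m ω‖ = ‖X m' ω‖ → m = m'} ⊆
          ⋃ q ∈ Finset.range (R * 2 ^ n),
            {ω | 2 ≤ pointCount (fun k => X k ω) (cell M i n q)} := by
        intro ω hω
        simp only [mem_ofPred_eq, not_forall] at hω
        obtain ⟨m, m', hm, hm', hR, heq, hne⟩ := hω
        simp only [mem_iUnion, Finset.mem_range, mem_ofPred_eq]
        refine ⟨⌊‖X m ω‖ * 2 ^ n⌋₊, ?_, two_le_pointCount hne ⟨hm, rfl⟩ ⟨hm', by rw [heq]⟩⟩
        rw [Nat.floor_lt (by positivity)]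
        push_cast
        gcongr
      refine (measure_mono hsub).trans ((measure_biUnion_finset_le _ _).trans ?_)
      have hb : ∀ q ∈ Finset.range (R * 2 ^ n),
          μ {ω | 2 ≤ pointCount (fun k => X k ω) (cell M i n q)} ≤
            ENNReal.ofReal ((lam * (Real.pi / M) * (2 * R) / 2 ^ n) ^ 2) := by
        intro q hq
        refine (hX.measure_two_le_pointCount (measurableSet_cell M i n q)
          (volume_cell_ne_top h1 hi) hlam).trans (ENNReal.ofReal_le_ofReal ?_)
        rw [mul_toReal_volume_cell h1 hi]
        refine pow_le_pow_left₀ (cellRate_nonneg hlam) ?_ 2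
        have hq' : (q : ℝ) + 1 ≤ R * 2 ^ n := by
          have : q + 1 ≤ R * 2 ^ n := Finset.mem_range.1 hq
          exact_mod_cast this
        have e : cellRate lam M n q = lam * (Real.pi / M) * ((2 * q + 1) / 2 ^ n) / 2 ^ n := by
          unfold cellRate
          ring
        have : (2 * (q : ℝ) + 1) / 2 ^ n ≤ 2 * R := by
          rw [div_le_iff₀ (by positivity)]
          linarith
        rw [e]
        gcongr
      refine (Finset.sum_le_sum hb).trans ?_
      rw [Finset.sum_const, Finset.card_range, nsmul_eq_mul, ← ENNReal.ofReal_natCast,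
        ← ENNReal.ofReal_mul (by positivity)]
      refine ENNReal.ofReal_le_ofReal (le_of_eq ?_)
      push_cast
      simp only [C, one_div, inv_pow]
      field_simp
  filter_upwards [ae_all_iff.2 key] with ω hω m m' hm hm' heq
  obtain ⟨R, hR⟩ := exists_nat_gt ‖X m ω‖
  exact hω R m m' hm hm' hR heq

variable [IsProbabilityMeasure μ]

lemma ae_norm_ne (hX : IsPoissonPointProcess X lam μ) (hlam : 0 ≤ lam) (r : ℝ) :
    ∀ᵐ ω ∂μ, ∀ m, ‖X m ω‖ ≠ r := by
  have h := ae_notMem_of_volume_eq_zero hX (B := Metric.sphere (0 : ℂ) r)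
    Metric.isClosed_sphere.measurableSet (Measure.addHaar_sphere _ _ _) hlam
  simpa using h

lemma ae_isRegular (hX : IsPoissonPointProcess X lam μ) (hlam : 0 < lam) (RC : ℝ) :
    ∀ᵐ ω ∂μ, IsRegular M RC (fun m => X m ω) := by
  have h1 : ∀ᵐ ω ∂μ, ∀ i ∈ Finset.Icc 1 M, ∃ m, X m ω ∈ sector M i :=
    (Finset.eventually_all _).2 fun i hi =>
      ae_exists_mem_sector hX hlam (Finset.mem_Icc.1 hi).1 (Finset.mem_Icc.1 hi).2
  have h2 : ∀ᵐ ω ∂μ, ∀ i ∈ Finset.Icc 1 M, ∀ m m', X m ω ∈ sector M i → X m' ω ∈ sector M i →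
      ‖X m ω‖ = ‖X m' ω‖ → m = m' :=
    (Finset.eventually_all _).2 fun i hi =>
      ae_norm_injOn_sector hX hlam.le (Finset.mem_Icc.1 hi).1 (Finset.mem_Icc.1 hi).2
  filter_upwards [h1, h2, ae_norm_ne hX hlam.le 0, ae_norm_ne hX hlam.le RC,
    ae_finite_norm_lt hX] with ω a1 a2 a3 a4 a5
  exact
    { norm_pos := fun m => lt_of_le_of_ne (norm_nonneg _) (a3 m).symm
      norm_ne := a4
      norm_inj := fun i m m' h1 hi => a2 i (Finset.mem_Icc.2 ⟨h1, hi⟩) m m'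
      finite := a5
      exists_mem := fun i h1 hi => a1 i (Finset.mem_Icc.2 ⟨h1, hi⟩) }

end Regular

/-! ### Discretised distances -/

/-- The index of the dyadic interval of length `2⁻ⁿ` that contains `r`. -/
noncomputable def level (n : ℕ) (r : ℝ) : ℕ := ⌊r * 2 ^ n⌋₊

/-- The ratio `Γ l(r₁) / l(r)`, with `r₁` rounded down and `r` rounded up to dyadic numbers. -/
noncomputable def levelRatio (l : ℝ → ℝ) (Γ : ℝ) (n q p : ℕ) : ℝ :=
  Γ * l ((q : ℝ) / 2 ^ n) / l ((p + 1 : ℝ) / 2 ^ n)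

@[fun_prop]
lemma measurable_level (n : ℕ) : Measurable (level n) :=
  Nat.measurable_floor.comp (measurable_id.mul_const _)

lemma level_mono (n : ℕ) : Monotone (level n) := fun r s h => Nat.floor_mono (by gcongr)

lemma level_div_le {r : ℝ} (hr : 0 ≤ r) (n : ℕ) : (level n r : ℝ) / 2 ^ n ≤ r :=
  ((floor_mul_eq_iff hr n _).1 rfl).1

lemma lt_level_add_one_div {r : ℝ} (hr : 0 ≤ r) (n : ℕ) : r < ((level n r : ℝ) + 1) / 2 ^ n :=
  ((floor_mul_eq_iff hr n _).1 rfl).2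

lemma tendsto_half_pow : Tendsto (fun n : ℕ => (1 : ℝ) / 2 ^ n) atTop (𝓝 0) := by
  have := tendsto_pow_atTop_nhds_zero_of_lt_one (r := (1 / 2 : ℝ)) (by norm_num) (by norm_num)
  simpa using this

lemma tendsto_level_div {r : ℝ} (hr : 0 ≤ r) :
    Tendsto (fun n => (level n r : ℝ) / 2 ^ n) atTop (𝓝 r) := by
  have h1 : Tendsto (fun n : ℕ => r - 1 / 2 ^ n) atTop (𝓝 r) := by
    simpa using tendsto_half_pow.const_sub r
  refine tendsto_of_tendsto_of_tendsto_of_le_of_le h1 tendsto_const_nhds (fun n => ?_)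
    fun n => level_div_le hr n
  have := lt_level_add_one_div hr n
  rw [add_div] at this
  simp only
  linarith

lemma tendsto_level_add_one_div {r : ℝ} (hr : 0 ≤ r) :
    Tendsto (fun n => ((level n r : ℝ) + 1) / 2 ^ n) atTop (𝓝 r) := by
  simpa [add_div] using (tendsto_level_div hr).add tendsto_half_pow

/-- With mesh `2⁻ⁿ`, the cutoff at level `4 ^ n` is the radius `2 ^ n`: the mesh shrinks while the
window grows. -/
lemma eventually_level_lt {r : ℝ} (hr : 0 ≤ r) : ∀ᶠ n in atTop, level n r < 4 ^ n := by
  have h : Tendsto (fun n : ℕ => (2 : ℝ) ^ n) atTop atTop :=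
    tendsto_pow_atTop_atTop_of_one_lt (by norm_num)
  filter_upwards [h.eventually_gt_atTop r] with n hn
  rw [level, Nat.floor_lt (by positivity)]
  push_cast
  rw [show (4 : ℝ) = 2 * 2 by norm_num, mul_pow]
  gcongr

lemma eventually_level_lt_level {r s : ℝ} (hr : 0 ≤ r) (hrs : r < s) :
    ∀ᶠ n in atTop, level n r < level n s := by
  have h := (tendsto_level_div hr).eventually_lt (tendsto_level_div (hr.trans hrs.le)) hrs
  filter_upwards [h] with n hn
  rw [div_lt_div_iff_of_pos_right (by positivity)] at hn
  exact_mod_cast hn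

lemma tendsto_level_ite {r s : ℝ} (hr : 0 ≤ r) (hrs : r ≠ s) {u : ℕ → ℝ≥0∞}
    {v : ℝ≥0∞} (hu : Tendsto u atTop (𝓝 v)) :
    Tendsto (fun n => if level n r < level n s ∧ level n s < 4 ^ n then u n else 0) atTop
      (𝓝 (if r < s then v else 0)) := by
  rcases lt_or_gt_of_ne hrs with h | h
  · rw [if_pos h]
    refine hu.congr' ?_
    filter_upwards [eventually_level_lt_level hr h, eventually_level_lt (hr.trans h.le)]
      with n h1 h2
    rw [if_pos ⟨h1, h2⟩]
  · rw [if_neg h.not_gt]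
    refine tendsto_const_nhds.congr fun n => ?_
    rw [if_neg fun h' => absurd h'.1 (not_lt.2 (level_mono n h.le))]

/-- Distinct levels force distinct distances, so discretisation only drops terms; this is the
domination that `tendsto_lintegral_of_le` asks for. -/
lemma level_ite_le {r s : ℝ} {n : ℕ} {u v : ℝ≥0∞} (huv : u ≤ v) :
    (if level n r < level n s ∧ level n s < 4 ^ n then u else 0) ≤ if r < s then v else 0 := by
  split_ifs with h1 h2
  · exact huv
  · exact absurd h1.1 (not_lt.2 (level_mono n (not_lt.1 h2)))
  · exact zero_le
  · exact le_rfl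

section Ratio

variable {l : ℝ → ℝ} {RC Γ r s : ℝ}

lemma levelRatio_nonneg (hl : IsPathLoss l RC) (hΓ : 0 < Γ) (n q p : ℕ) :
    0 ≤ levelRatio l Γ n q p := by
  have h1 := hl.nonneg ((q : ℝ) / 2 ^ n) (by positivity)
  have h2 := hl.nonneg ((p + 1 : ℝ) / 2 ^ n) (by positivity)
  unfold levelRatio
  positivity

/-- Rounding the numerator's distance down and the denominator's up, with `l` non-decreasing, keeps
the approximation below its limit. -/
lemma levelRatio_le (hl : IsPathLoss l RC) (hΓ : 0 < Γ) (hr : 0 ≤ r) (hs : 0 < s) (n : ℕ) :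
    levelRatio l Γ n (level n r) (level n s) ≤ Γ * l r / l s := by
  have h1 : l ((level n r : ℝ) / 2 ^ n) ≤ l r :=
    hl.mono (mem_Ici.2 (by positivity)) hr (level_div_le hr n)
  have h2 : l s ≤ l (((level n s : ℝ) + 1) / 2 ^ n) :=
    hl.mono hs.le (mem_Ici.2 (by positivity)) (lt_level_add_one_div hs.le n).le
  have h3 := hl.pos s hs
  have h4 := hl.nonneg r hr
  unfold levelRatio
  gcongr

lemma tendsto_levelRatio (hl : IsPathLoss l RC) (hr : 0 < r) (hrC : r ≠ RC) (hs : 0 < s)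
    (hsC : s ≠ RC) :
    Tendsto (fun n => levelRatio l Γ n (level n r) (level n s)) atTop (𝓝 (Γ * l r / l s)) :=
  (((hl.continuousAt r hr hrC).tendsto.comp (tendsto_level_div hr.le)).const_mul Γ).div
    ((hl.continuousAt s hs hsC).tendsto.comp (tendsto_level_add_one_div hs.le))
    (hl.pos s hs).ne'

end Ratio

/-! ### The discretised exponent of the detection probability -/

open Classical in
/-- The approximation at level `n` of the exponent of the detection probability, as a function of
the numbers of points at the levels `0, 1, …, 4 ^ n - 1`. -/
noncomputable def levelExponent (l : ℝ → ℝ) (M : ℕ) (Γ Pw W : ℝ) (n : ℕ) (N : ℕ → ℝ≥0∞) : ℝ≥0∞ :=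
  ∑ q ∈ Finset.range (4 ^ n), if (∀ p < q, N p = 0) ∧ N q ≠ 0 then
    ENNReal.ofReal (W * Γ * l ((q : ℝ) / 2 ^ n) / (Pw * M)) +
      ∑ p ∈ Finset.Ioo q (4 ^ n), N p * ENNReal.ofReal (Real.log (1 + levelRatio l Γ n q p))
    else 0

/-- The numbers of points of the configuration `x` in the cells of sector `i`. -/
noncomputable def levelCount (M : ℕ) (x : ℕ → ℂ) (i n q : ℕ) : ℝ≥0∞ := pointCount x (cell M i n q)

lemma mem_cell {M i n q : ℕ} {z : ℂ} : z ∈ cell M i n q ↔ z ∈ sector M i ∧ level n ‖z‖ = q :=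
  Iff.rfl

section Exponent

variable {l : ℝ → ℝ} {RC : ℝ} {M : ℕ} {x : ℕ → ℂ} {i k : ℕ} {Γ Pw W : ℝ}

lemma measurable_levelExponent (n : ℕ) : Measurable (levelExponent l M Γ Pw W n) := by
  classical
  unfold levelExponent
  refine Finset.measurable_sum _ fun q _ => Measurable.ite ?_ (by fun_prop) measurable_const
  have h0 : ∀ p, MeasurableSet {N : ℕ → ℝ≥0∞ | N p = 0} := fun p =>
    measurable_pi_apply p (measurableSet_singleton 0)
  have e : {N : ℕ → ℝ≥0∞ | (∀ p < q, N p = 0) ∧ N q ≠ 0} =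
      (⋂ p ∈ Finset.range q, {N | N p = 0}) ∩ {N | N q = 0}ᶜ := by
    ext N
    simp
  rw [e]
  exact (Finset.measurableSet_biInter _ fun p _ => h0 p).inter (h0 q).compl

lemma sum_levelCount_mul (n : ℕ) (s : Finset ℕ) (g : ℕ → ℝ≥0∞) :
    ∑ p ∈ s, levelCount M x i n p * g p =
      ∑' m, (sector M i).indicator
        (fun z => if level n ‖z‖ ∈ s then g (level n ‖z‖) else 0) (x m) := by
  classical
  simp only [levelCount, pointCount, ← ENNReal.tsum_mul_right]
  rw [← Summable.tsum_finsetSum fun _ _ => ENNReal.summable]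
  refine tsum_congr fun m => ?_
  by_cases hm : x m ∈ sector M i
  · rw [indicator_of_mem hm]
    simp only [indicator_apply, mem_cell, hm, true_and, Pi.one_apply, ite_mul, one_mul, zero_mul]
    rw [Finset.sum_ite_eq]
  · simp [hm, mem_cell]

/-- The first nonempty level is that of the closest station, so one summand survives. Other stations
on that level are ignored at stage `n`. -/
lemma IsClosest.levelExponent_eq (hk : IsClosest M x i k) {n : ℕ}
    (hn : level n ‖x k‖ < 4 ^ n) :
    levelExponent l M Γ Pw W n (levelCount M x i n) =
      ENNReal.ofReal (W * Γ * l ((level n ‖x k‖ : ℝ) / 2 ^ n) / (Pw * M)) +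
        ∑' m, (sector M i).indicator
          (fun z => if level n ‖x k‖ < level n ‖z‖ ∧ level n ‖z‖ < 4 ^ n then
            ENNReal.ofReal (Real.log (1 + levelRatio l Γ n (level n ‖x k‖) (level n ‖z‖))) else 0)
          (x m) := by
  classical
  have hle : ∀ m, x m ∈ sector M i → level n ‖x k‖ ≤ level n ‖x m‖ := by
    intro m hm
    rcases eq_or_ne m k with rfl | hne
    · exact le_rfl
    · exact level_mono n (hk.2 m hm hne).le
  have hfirst : ∀ q, ((∀ p < q, levelCount M x i n p = 0) ∧ levelCount M x i n q ≠ 0) ↔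
      q = level n ‖x k‖ := by
    intro q
    have hne : levelCount M x i n (level n ‖x k‖) ≠ 0 := fun h =>
      pointCount_eq_zero_iff.1 h k ⟨hk.1, rfl⟩
    constructor
    · rintro ⟨h1, h2⟩
      refine le_antisymm (not_lt.1 fun h => hne (h1 _ h)) (not_lt.1 fun h => h2 ?_)
      exact pointCount_eq_zero_iff.2 fun m hm => absurd (hle m hm.1) (not_le.2 (hm.2.trans_lt h))
    · rintro rfl
      exact ⟨fun p hp => pointCount_eq_zero_iff.2 fun m hm =>
        absurd (hle m hm.1) (not_le.2 (hm.2.trans_lt hp)), hne⟩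
  unfold levelExponent
  simp only [hfirst]
  rw [Finset.sum_ite_eq', if_pos (Finset.mem_range.2 hn), sum_levelCount_mul]
  simp only [Finset.mem_Ioo]

/-- Each term lies below its limit and converges to it: distinct distances are eventually on
distinct levels, and no distance is the possible discontinuity `RC`. -/
lemma tendsto_levelExponent (hl : IsPathLoss l RC) (hx : IsRegular M RC x)
    (hk : IsClosest M x i k) (hΓ : 0 < Γ) :
    Tendsto (fun n => levelExponent l M Γ Pw W n (levelCount M x i n)) atTop
      (𝓝 (detectExponent l M Γ Pw W x i k)) := by
  classical
  have hkp := hx.norm_pos k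
  have hev : ∀ᶠ n in atTop, _ = levelExponent l M Γ Pw W n (levelCount M x i n) :=
    (eventually_level_lt hkp.le).mono fun n hn => (hk.levelExponent_eq hn).symm
  refine Tendsto.congr' hev (Tendsto.add ?_ ?_)
  · refine ENNReal.tendsto_ofReal (Tendsto.div_const (Tendsto.const_mul _ ?_) _)
    exact (hl.continuousAt _ hkp (hx.norm_ne k)).tendsto.comp (tendsto_level_div hkp.le)
  · have hlog : ∀ {s : ℝ}, 0 ≤ s → (1 : ℝ) + s ≠ 0 := fun hs => by linarith
    have hr0 : ∀ m, 0 ≤ Γ * l ‖x k‖ / l ‖x m‖ := fun m => by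
      have h1 := hl.nonneg _ (norm_nonneg (x k))
      have h2 := hl.nonneg _ (norm_nonneg (x m))
      positivity
    have hrw : ∀ m, (if x m ∈ sector M i ∧ m ≠ k then
        ENNReal.ofReal (Real.log (1 + Γ * l ‖x k‖ / l ‖x m‖)) else 0) =
        (sector M i).indicator (fun z => if ‖x k‖ < ‖z‖ then
          ENNReal.ofReal (Real.log (1 + Γ * l ‖x k‖ / l ‖z‖)) else 0) (x m) := by
      intro m
      by_cases hm : x m ∈ sector M i
      · rw [indicator_of_mem hm]
        have : m ≠ k ↔ ‖x k‖ < ‖x m‖ :=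
          ⟨hk.2 m hm, fun h h' => by subst h'; exact lt_irrefl _ h⟩
        simp only [hm, true_and, this]
      · simp [hm]
    simp only [hrw]
    refine tendsto_tsum_of_le (fun n m => ?_) fun m => ?_
    · refine indicator_rel_indicator le_rfl fun _ => level_ite_le (ENNReal.ofReal_le_ofReal ?_)
      have h0 := levelRatio_nonneg hl hΓ n (level n ‖x k‖) (level n ‖x m‖)
      refine Real.log_le_log (by linarith) ?_
      linarith [levelRatio_le hl hΓ hkp.le (hx.norm_pos m) n]
    · by_cases hm : x m ∈ sector M i
      · simp only [indicator_of_mem hm]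
        rcases eq_or_ne m k with rfl | hne
        · simp
        · refine tendsto_level_ite hkp.le (hk.2 m hm hne).ne (ENNReal.tendsto_ofReal ?_)
          exact ((tendsto_levelRatio hl hkp (hx.norm_ne k) (hx.norm_pos m)
            (hx.norm_ne m)).const_add 1).log (hlog (hr0 m))
      · simp [hm]

end Exponent

/-! ### The transform of the discretised exponent -/

section Independence

variable {Ω : Type*} [MeasurableSpace Ω] {μ : Measure Ω} {X : ℕ → Ω → ℂ} {lam : ℝ} {M : ℕ}

lemma IsPoissonPointProcess.iIndepFun_pointCount (hX : IsPoissonPointProcess X lam μ)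
    {ι : Type*} {B : ι → Set ℂ} (hB : ∀ i, MeasurableSet (B i)) (hfin : ∀ i, volume (B i) ≠ ∞)
    (hd : Pairwise fun i j => Disjoint (B i) (B j)) :
    iIndepFun (fun i ω => pointCount (fun n => X n ω) (B i)) μ := by
  refine iIndepFun_iff_finset.2 fun s => ?_
  have h := hX.indep_count s.card (fun j => B (s.equivFin.symm j)) (fun _ => hB _)
    (fun _ => hfin _) fun a b hab => hd fun h => hab (s.equivFin.symm.injective (Subtype.ext h))
  have h2 := h.precomp s.equivFin.injective
  simp only [Equiv.symm_apply_apply] at h2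
  exact h2

lemma iIndepFun_levelCount (hX : IsPoissonPointProcess X lam μ) (hM : 1 ≤ M) (n : ℕ) :
    iIndepFun (fun (p : (_ : Finset.Icc 1 M) × ℕ) ω =>
      levelCount M (fun m => X m ω) p.1 n p.2) μ := by
  refine hX.iIndepFun_pointCount (B := fun p : (_ : Finset.Icc 1 M) × ℕ => cell M p.1 n p.2)
    (fun p => measurableSet_cell _ _ _ _) (fun p => ?_) ?_
  · have := Finset.mem_Icc.1 p.1.2
    exact volume_cell_ne_top this.1 this.2
  · rintro ⟨i, q⟩ ⟨j, p⟩ hne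
    rw [Set.disjoint_left]
    rintro z hz hz'
    rw [mem_cell] at hz hz'
    obtain rfl : i = j := by
      by_contra hij
      exact Set.disjoint_left.1 (disjoint_sector hM fun h => hij (Subtype.ext h)) hz.1 hz'.1
    obtain rfl : q = p := hz.2.symm.trans hz'.2
    exact hne rfl

lemma measurable_levelCount (hX : IsPoissonPointProcess X lam μ) (i n q : ℕ) :
    Measurable fun ω => levelCount M (fun m => X m ω) i n q :=
  measurable_pointCount hX.measurable_point (measurableSet_cell M i n q)

lemma iIndepFun_levelCount_sectors (hX : IsPoissonPointProcess X lam μ) (hM : 1 ≤ M) (n : ℕ) :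
    iIndepFun (fun (i : Finset.Icc 1 M) ω => levelCount M (fun m => X m ω) i n) μ :=
  iIndepFun_curry (X := fun (i : Finset.Icc 1 M) q ω => levelCount M (fun m => X m ω) i n q)
    (fun i q => measurable_levelCount hX i n q) (iIndepFun_levelCount hX hM n)

lemma iIndepFun_levelCount_sector (hX : IsPoissonPointProcess X lam μ) {i : ℕ} (h1 : 1 ≤ i)
    (hi : i ≤ M) (n : ℕ) :
    iIndepFun (fun q ω => levelCount M (fun m => X m ω) i n q) μ := by
  have h := iIndepFun_levelCount hX (h1.trans hi) n
  exact h.precomp (g := fun q : ℕ =>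
    (⟨⟨i, Finset.mem_Icc.2 ⟨h1, hi⟩⟩, q⟩ : (_ : Finset.Icc 1 M) × ℕ)) fun a b hab => by
    simpa using hab

variable {i n q : ℕ}

/-- Every point of the cell contributes a factor `(1 / (1 + a)) ^ k`: this is the Poisson generating
function at that value. -/
lemma lintegral_pow_levelCount (hX : IsPoissonPointProcess X lam μ) (hlam : 0 ≤ lam) (h1 : 1 ≤ i)
    (hi : i ≤ M) {a : ℝ} (ha : 0 ≤ a) (k : ℕ) :
    ∫⁻ ω, nexp (k * (levelCount M (fun m => X m ω) i n q *
      ENNReal.ofReal (Real.log (1 + a)))) ∂μ =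
      nexp (ENNReal.ofReal (cellRate lam M n q * (1 - (1 / (1 + a)) ^ k))) := by
  unfold levelCount
  rw [hX.lintegral_pointCount (measurableSet_cell M i n q) (volume_cell_ne_top h1 hi)
    (g := fun t => nexp (k * (t * ENNReal.ofReal (Real.log (1 + a))))) (by fun_prop),
    mul_toReal_volume_cell h1 hi]
  have e : ∀ t : ℕ, nexp (k * (t * ENNReal.ofReal (Real.log (1 + a)))) =
      ENNReal.ofReal ((1 / (1 + a)) ^ k) ^ t := by
    intro t
    rw [mul_left_comm, nexp_natCast_mul, nexp_natCast_mul, nexp_log_one_add ha,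
      ENNReal.ofReal_pow (by positivity)]
  simp only [e]
  rw [lintegral_pow_poissonMeasure _ (by positivity)
    (pow_le_one₀ (by positivity) (div_le_one_of_le₀ (by linarith) (by linarith))),
    Real.coe_toNNReal _ (cellRate_nonneg hlam)]

lemma measure_levelCount_eq_zero (hX : IsPoissonPointProcess X lam μ) (hlam : 0 ≤ lam)
    (h1 : 1 ≤ i) (hi : i ≤ M) :
    μ {ω | levelCount M (fun m => X m ω) i n q = 0} =
      nexp (ENNReal.ofReal (cellRate lam M n q)) := by
  unfold levelCount
  rw [hX.measure_pointCount_eq_zero (measurableSet_cell M i n q) (volume_cell_ne_top h1 hi) hlam,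
    mul_toReal_volume_cell h1 hi]

end Independence

open Classical in
lemma lintegral_ite_eq_zero {Ω : Type*} [MeasurableSpace Ω] {μ : Measure Ω} {f : Ω → ℝ≥0∞}
    (hf : Measurable f) : ∫⁻ ω, (if f ω = 0 then (1 : ℝ≥0∞) else 0) ∂μ = μ {ω | f ω = 0} := by
  have hm : MeasurableSet {ω | f ω = 0} := hf (measurableSet_singleton 0)
  rw [← lintegral_indicator_one hm]
  refine lintegral_congr fun ω => ?_
  by_cases h : f ω = 0 <;> simp [h]

section Transform

variable {l : ℝ → ℝ} {RC : ℝ} {M : ℕ} {Γ Pw W lam : ℝ}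

-- Case distinction on the first nonempty level; the last product is the case of no points at all,
-- where the exponent is `0`. Each summand is a product of functions of single counts, ready for
-- independence.
open Classical in
lemma nexp_levelExponent (k n : ℕ) (N : ℕ → ℝ≥0∞) :
    nexp (k * levelExponent l M Γ Pw W n N) =
      (∑ q ∈ Finset.range (4 ^ n),
        nexp (k * ENNReal.ofReal (W * Γ * l ((q : ℝ) / 2 ^ n) / (Pw * M))) *
          ((∏ p ∈ Finset.range q, if N p = 0 then 1 else 0) * (if N q = 0 then 0 else 1) *
          ∏ p ∈ Finset.Ioo q (4 ^ n),
            nexp (k * (N p * ENNReal.ofReal (Real.log (1 + levelRatio l Γ n q p)))))) +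
      ∏ p ∈ Finset.range (4 ^ n), if N p = 0 then 1 else 0 := by
  have hprod : ∀ Q, (∏ p ∈ Finset.range Q, if N p = 0 then (1 : ℝ≥0∞) else 0) =
      if ∀ p < Q, N p = 0 then 1 else 0 := by
    intro Q
    simp only [Finset.prod_ite_zero, Finset.prod_const_one, Finset.mem_range]
  have hind : ∀ q, (∏ p ∈ Finset.range q, if N p = 0 then (1 : ℝ≥0∞) else 0) *
      (if N q = 0 then 0 else 1) = if (∀ p < q, N p = 0) ∧ N q ≠ 0 then 1 else 0 := by
    intro q
    rw [hprod]
    by_cases h1 : ∀ p < q, N p = 0 <;> by_cases h2 : N q = 0 <;> simp [h1, h2]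
  simp only [hind, levelExponent]
  rw [hprod]
  by_cases h : ∀ p < 4 ^ n, N p = 0
  · rw [if_pos h, Finset.sum_eq_zero, Finset.sum_eq_zero]
    · simp
    · intro q hq
      rw [if_neg fun h' => h'.2 (h q (Finset.mem_range.1 hq))]
      simp
    · intro q hq
      rw [if_neg fun h' => h'.2 (h q (Finset.mem_range.1 hq))]
  · have hex : ∃ p, N p ≠ 0 := by
      push Not at h
      exact h.imp fun p hp => hp.2
    have hfirst : ∀ q, ((∀ p < q, N p = 0) ∧ N q ≠ 0) ↔ q = Nat.find hex := by
      intro q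
      rw [eq_comm, Nat.find_eq_iff, and_comm]
      simp only [not_not]
    have hlt : Nat.find hex < 4 ^ n := by
      push Not at h
      obtain ⟨p, hp, hp0⟩ := h
      exact (Nat.find_min' hex hp0).trans_lt hp
    simp only [hfirst, if_neg h, add_zero, ite_mul, mul_ite, one_mul, zero_mul, mul_zero]
    rw [Finset.sum_ite_eq', Finset.sum_ite_eq', if_pos (Finset.mem_range.2 hlt), mul_add,
      nexp_add, Finset.mul_sum, nexp_sum]
    simp [Finset.mem_range.2 hlt]

variable {Ω : Type*} [MeasurableSpace Ω] {μ : Measure Ω} [IsProbabilityMeasure μ]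
  {X : ℕ → Ω → ℂ} {i : ℕ}

open Classical in
lemma lintegral_levelCount_prod (hl : IsPathLoss l RC) (hX : IsPoissonPointProcess X lam μ)
    (hlam : 0 ≤ lam) (hΓ : 0 < Γ) (h1 : 1 ≤ i) (hi : i ≤ M) (k n q Q : ℕ) :
    ∫⁻ ω, ((∏ p ∈ Finset.range q, if levelCount M (fun m => X m ω) i n p = 0 then 1 else 0) *
      (if levelCount M (fun m => X m ω) i n q = 0 then 0 else 1) *
      ∏ p ∈ Finset.Ioo q Q, nexp (k * (levelCount M (fun m => X m ω) i n p *
        ENNReal.ofReal (Real.log (1 + levelRatio l Γ n q p))))) ∂μ =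
    nexp (∑ p ∈ Finset.range q, ENNReal.ofReal (cellRate lam M n p)) *
      (1 - nexp (ENNReal.ofReal (cellRate lam M n q))) *
      nexp (∑ p ∈ Finset.Ioo q Q, ENNReal.ofReal (cellRate lam M n p *
        (1 - (1 / (1 + levelRatio l Γ n q p)) ^ k))) := by
  -- One factor per cell: empty below `q`, nonempty at `q`, interference weight above `q`.
  let φ : ℕ → ℝ≥0∞ → ℝ≥0∞ := fun p t =>
    if p < q then (if t = 0 then 1 else 0) else if p = q then (if t = 0 then 0 else 1) else
      nexp (k * (t * ENNReal.ofReal (Real.log (1 + levelRatio l Γ n q p))))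
  have hφ : ∀ p, Measurable (φ p) := by
    intro p
    have h0 : MeasurableSet {t : ℝ≥0∞ | t = 0} := measurableSet_singleton 0
    simp only [φ]
    split_ifs
    · exact Measurable.ite h0 measurable_const measurable_const
    · exact Measurable.ite h0 measurable_const measurable_const
    · fun_prop
  have hsplit : ∀ f : ℕ → ℝ≥0∞, ∏ p ∈ Finset.range q ∪ {q} ∪ Finset.Ioo q Q, f p =
      (∏ p ∈ Finset.range q, f p) * f q * ∏ p ∈ Finset.Ioo q Q, f p := by
    intro f
    rw [Finset.prod_union, Finset.prod_union, Finset.prod_singleton]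
    · simp
    · rw [Finset.disjoint_left]
      intro p hp hp'
      simp only [Finset.mem_union, Finset.mem_range, Finset.mem_singleton] at hp
      simp only [Finset.mem_Ioo] at hp'
      omega
  have e1 : ∀ p ∈ Finset.range q, φ p = fun t => if t = 0 then 1 else 0 := by
    intro p hp
    simp [φ, Finset.mem_range.1 hp]
  have e2 : φ q = fun t => if t = 0 then 0 else 1 := by simp [φ]
  have e3 : ∀ p ∈ Finset.Ioo q Q, φ p = fun t =>
      nexp (k * (t * ENNReal.ofReal (Real.log (1 + levelRatio l Γ n q p)))) := by
    intro p hp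
    have := (Finset.mem_Ioo.1 hp).1
    simp [φ, this.not_gt, this.ne']
  have hmz : ∀ p, MeasurableSet {ω | levelCount M (fun m => X m ω) i n p = 0} := fun p =>
    measurable_levelCount hX i n p (measurableSet_singleton 0)
  have hz : ∀ p, ∫⁻ ω, (if levelCount M (fun m => X m ω) i n p = 0 then (1 : ℝ≥0∞) else 0) ∂μ =
      nexp (ENNReal.ofReal (cellRate lam M n p)) := by
    intro p
    rw [← measure_levelCount_eq_zero hX hlam h1 hi,
      lintegral_ite_eq_zero (measurable_levelCount hX i n p)]
  have hnz : ∫⁻ ω, (if levelCount M (fun m => X m ω) i n q = 0 then (0 : ℝ≥0∞) else 1) ∂μ =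
      1 - nexp (ENNReal.ofReal (cellRate lam M n q)) := by
    rw [← measure_levelCount_eq_zero hX hlam h1 hi, ← measure_univ (μ := μ),
      ← measure_compl (hmz q) (measure_ne_top _ _), ← lintegral_indicator_one (hmz q).compl]
    refine lintegral_congr fun ω => ?_
    by_cases h : levelCount M (fun m => X m ω) i n q = 0 <;> simp [h]
  calc _ = ∫⁻ ω, ∏ p ∈ Finset.range q ∪ {q} ∪ Finset.Ioo q Q,
        φ p (levelCount M (fun m => X m ω) i n p) ∂μ := by
        refine lintegral_congr fun ω => ?_
        rw [hsplit, e2]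
        congr 1
        · congr 1
          exact Finset.prod_congr rfl fun p hp => by rw [e1 p hp]
        · exact Finset.prod_congr rfl fun p hp => by rw [e3 p hp]
    _ = ∏ p ∈ Finset.range q ∪ {q} ∪ Finset.Ioo q Q,
        ∫⁻ ω, φ p (levelCount M (fun m => X m ω) i n p) ∂μ :=
        lintegral_prod_eq_prod_lintegral_of_indepFun _
          (fun p ω => φ p (levelCount M (fun m => X m ω) i n p))
          ((iIndepFun_levelCount_sector hX h1 hi n).comp φ hφ)
          fun p => (hφ p).comp (measurable_levelCount hX i n p)
    _ = _ := by
        rw [hsplit, e2, hnz, nexp_sum, nexp_sum]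
        congr 1
        · congr 1
          exact Finset.prod_congr rfl fun p hp => by rw [e1 p hp, hz]
        · exact Finset.prod_congr rfl fun p hp => by
            rw [e3 p hp, lintegral_pow_levelCount hX hlam h1 hi (levelRatio_nonneg hl hΓ _ _ _)]

lemma lintegral_nexp_levelExponent (hl : IsPathLoss l RC) (hX : IsPoissonPointProcess X lam μ)
    (hlam : 0 ≤ lam) (hΓ : 0 < Γ) (h1 : 1 ≤ i) (hi : i ≤ M) (k n : ℕ) :
    ∫⁻ ω, nexp (k * levelExponent l M Γ Pw W n (levelCount M (fun m => X m ω) i n)) ∂μ =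
      (∑ q ∈ Finset.range (4 ^ n),
        nexp (k * ENNReal.ofReal (W * Γ * l ((q : ℝ) / 2 ^ n) / (Pw * M))) *
          (nexp (∑ p ∈ Finset.range q, ENNReal.ofReal (cellRate lam M n p)) *
            (1 - nexp (ENNReal.ofReal (cellRate lam M n q))) *
            nexp (∑ p ∈ Finset.Ioo q (4 ^ n), ENNReal.ofReal (cellRate lam M n p *
              (1 - (1 / (1 + levelRatio l Γ n q p)) ^ k))))) +
      nexp (∑ p ∈ Finset.range (4 ^ n), ENNReal.ofReal (cellRate lam M n p)) := by
  classical
  have hm := fun p => measurable_levelCount (M := M) hX i n p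
  have hmz : ∀ p (a b : ℝ≥0∞), Measurable fun ω =>
      if levelCount M (fun m => X m ω) i n p = 0 then a else b := fun p a b =>
    Measurable.ite (hm p (measurableSet_singleton 0)) measurable_const measurable_const
  have hmprod : ∀ q, Measurable fun ω =>
      ∏ p ∈ Finset.range q, if levelCount M (fun m => X m ω) i n p = 0 then (1 : ℝ≥0∞) else 0 :=
    fun q => Finset.measurable_prod _ fun p _ => hmz p 1 0
  have hmall : ∀ q, Measurable fun ω =>
      ((∏ p ∈ Finset.range q, if levelCount M (fun m => X m ω) i n p = 0 then (1 : ℝ≥0∞) else 0) *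
      (if levelCount M (fun m => X m ω) i n q = 0 then 0 else 1) *
      ∏ p ∈ Finset.Ioo q (4 ^ n), nexp (k * (levelCount M (fun m => X m ω) i n p *
        ENNReal.ofReal (Real.log (1 + levelRatio l Γ n q p))))) := fun q =>
    ((hmprod q).mul (hmz q 0 1)).mul (Finset.measurable_prod _ fun p _ =>
      measurable_nexp.comp (((hm p).mul_const _).const_mul _))
  simp only [nexp_levelExponent]
  rw [lintegral_add_right _ (hmprod _), lintegral_finsetSum _ fun q _ => (hmall q).const_mul _]
  congr 1
  · refine Finset.sum_congr rfl fun q _ => ?_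
    rw [lintegral_const_mul _ (hmall q), lintegral_levelCount_prod hl hX hlam hΓ h1 hi]
  · rw [lintegral_prod_eq_prod_lintegral_of_indepFun _
      (fun p ω => if levelCount M (fun m => X m ω) i n p = 0 then (1 : ℝ≥0∞) else 0)
      ((iIndepFun_levelCount_sector hX h1 hi n).comp (fun _ t => if t = 0 then 1 else 0)
        fun p => Measurable.ite (measurableSet_singleton 0) measurable_const measurable_const)
      fun p => hmz p 1 0, nexp_sum]
    refine Finset.prod_congr rfl fun p _ => ?_
    rw [← measure_levelCount_eq_zero hX hlam h1 hi, lintegral_ite_eq_zero (hm p)]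

end Transform

/-! ### The intensity of the distances and the law of the smallest distance -/

/-- The intensity measure of the distances of the points in one sector. -/
noncomputable def radialMeasure (lam : ℝ) (M : ℕ) : Measure ℝ :=
  (volume.restrict (Ioi 0)).withDensity fun r => ENNReal.ofReal (2 * Real.pi * lam / M * r)

/-- The density of the smallest distance of the points in one sector. -/
noncomputable def closestDensity (lam : ℝ) (M : ℕ) (r : ℝ) : ℝ :=
  2 * lam * Real.pi * r / M * Real.exp (-(lam * Real.pi * r ^ 2 / M))

/-- The law of the smallest distance of the points in one sector. -/
noncomputable def closestMeasure (lam : ℝ) (M : ℕ) : Measure ℝ :=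
  (volume.restrict (Ioi 0)).withDensity fun r => ENNReal.ofReal (closestDensity lam M r)

@[fun_prop]
lemma continuous_closestDensity (lam : ℝ) (M : ℕ) : Continuous (closestDensity lam M) := by
  unfold closestDensity
  fun_prop

section Measures

variable {lam : ℝ} {M : ℕ}

lemma closestDensity_nonneg (hlam : 0 ≤ lam) {r : ℝ} (hr : 0 ≤ r) :
    0 ≤ closestDensity lam M r := by
  have := Real.pi_pos
  unfold closestDensity
  positivity

lemma integrable_closestDensity (hlam : 0 < lam) (hM : 1 ≤ M) :
    Integrable (closestDensity lam M) := by
  have hM' : (0 : ℝ) < M := by exact_mod_cast hM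
  have hπ := Real.pi_pos
  have h := (integrable_mul_exp_neg_mul_sq (b := lam * Real.pi / M) (by positivity)).const_mul
    (2 * lam * Real.pi / M)
  refine h.congr (Eventually.of_forall fun r => ?_)
  simp only [closestDensity]
  rw [show -(lam * Real.pi / M) * r ^ 2 = -(lam * Real.pi * r ^ 2 / M) by ring]
  ring

lemma isFiniteMeasure_closestMeasure (hlam : 0 < lam) (hM : 1 ≤ M) :
    IsFiniteMeasure (closestMeasure lam M) := by
  refine isFiniteMeasure_withDensity_ofReal ?_
  exact (integrable_closestDensity hlam hM).integrableOn.2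

lemma ae_radialMeasure {p : ℝ → Prop} (h : ∀ᵐ r : ℝ, 0 < r → p r) :
    ∀ᵐ r ∂(radialMeasure lam M), p r :=
  (withDensity_absolutelyContinuous _ _).ae_le ((ae_restrict_iff' measurableSet_Ioi).2 h)

lemma ae_closestMeasure {p : ℝ → Prop} (h : ∀ᵐ r : ℝ, 0 < r → p r) :
    ∀ᵐ r ∂(closestMeasure lam M), p r :=
  (withDensity_absolutelyContinuous _ _).ae_le ((ae_restrict_iff' measurableSet_Ioi).2 h)

lemma measurableSet_level_eq (n q : ℕ) : MeasurableSet {r | level n r = q} :=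
  measurable_level n (measurableSet_singleton q)

lemma withDensity_level_eq (f : ℝ → ℝ≥0∞) (n q : ℕ) :
    (volume.restrict (Ioi 0)).withDensity f {r | level n r = q} =
      ∫⁻ r in Ioc ((q : ℝ) / 2 ^ n) ((q + 1 : ℝ) / 2 ^ n), f r := by
  have h0 : (0 : ℝ) ≤ (q : ℝ) / 2 ^ n := by positivity
  have e : {r | level n r = q} ∩ Ioi 0 =
      Ico ((q : ℝ) / 2 ^ n) ((q + 1 : ℝ) / 2 ^ n) ∩ Ioi 0 := by
    ext r
    exact and_congr_left fun hr => floor_mul_eq_iff (le_of_lt hr) n q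
  have e2 : (Ico ((q : ℝ) / 2 ^ n) ((q + 1 : ℝ) / 2 ^ n) ∩ Ici 0 : Set ℝ) =
      Ico ((q : ℝ) / 2 ^ n) ((q + 1 : ℝ) / 2 ^ n) :=
    inter_eq_left.2 fun r hr => h0.trans hr.1
  have h1 : (Ico ((q : ℝ) / 2 ^ n) ((q + 1 : ℝ) / 2 ^ n) ∩ Ioi 0 : Set ℝ) =ᵐ[volume]
      (Ico ((q : ℝ) / 2 ^ n) ((q + 1 : ℝ) / 2 ^ n) ∩ Ici 0 : Set ℝ) :=
    (ae_eq_refl _).inter Ioi_ae_eq_Ici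
  rw [e2] at h1
  rw [withDensity_apply _ (measurableSet_level_eq n q),
    Measure.restrict_restrict (measurableSet_level_eq n q), e,
    setLIntegral_congr (h1.trans Ico_ae_eq_Ioc)]

lemma setLIntegral_Ioc_ofReal {f g : ℝ → ℝ} {a b : ℝ} (ha : 0 ≤ a) (hab : a ≤ b)
    (hf : Continuous f) (hf0 : ∀ r, 0 ≤ r → 0 ≤ f r) (hg : ∀ r, HasDerivAt g (f r) r) :
    ∫⁻ r in Ioc a b, ENNReal.ofReal (f r) = ENNReal.ofReal (g b - g a) := by
  rw [← ofReal_integral_eq_lintegral_ofReal, ← intervalIntegral.integral_of_le hab,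
    intervalIntegral.integral_eq_sub_of_hasDerivAt (fun r _ => hg r) (hf.intervalIntegrable a b)]
  · exact hf.integrableOn_Icc.mono_set Ioc_subset_Icc_self
  · exact (ae_restrict_iff' measurableSet_Ioc).2
      (Eventually.of_forall fun r hr => hf0 r (ha.trans hr.1.le))

lemma radialMeasure_level_eq (hlam : 0 ≤ lam) (n q : ℕ) :
    radialMeasure lam M {r | level n r = q} = ENNReal.ofReal (cellRate lam M n q) := by
  have hπ := Real.pi_pos
  rw [radialMeasure, withDensity_level_eq, setLIntegral_Ioc_ofReal (by positivity)
    (by gcongr; linarith) (by fun_prop) (fun r hr => by positivity)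
    (g := fun r => lam * Real.pi / M * r ^ 2) fun r => ?_, cellRate]
  · congr 1
    ring
  · refine ((hasDerivAt_pow 2 r).const_mul (lam * Real.pi / M)).congr_deriv ?_
    push_cast
    ring

lemma sum_cellRate (hlam : 0 ≤ lam) (n q : ℕ) :
    ∑ p ∈ Finset.range q, ENNReal.ofReal (cellRate lam M n p) =
      ENNReal.ofReal (lam * Real.pi / M * ((q : ℝ) / 2 ^ n) ^ 2) := by
  rw [← ENNReal.ofReal_sum_of_nonneg fun _ _ => cellRate_nonneg hlam]
  congr 1
  have h := Finset.sum_range_sub (fun p : ℕ => lam * Real.pi / M * ((p : ℝ) / 2 ^ n) ^ 2) q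
  rw [Nat.cast_zero, zero_div, zero_pow two_ne_zero, mul_zero, sub_zero] at h
  rw [← h]
  refine Finset.sum_congr rfl fun p _ => ?_
  rw [cellRate]
  push_cast
  ring

/-- Both sides are the probability that `q` is the first nonempty level. The density has primitive
`-exp (-lam π r² / M)`, and the rates of the lower cells telescope. -/
lemma closestMeasure_level_eq (hlam : 0 ≤ lam) (n q : ℕ) :
    closestMeasure lam M {r | level n r = q} =
      nexp (∑ p ∈ Finset.range q, ENNReal.ofReal (cellRate lam M n p)) *
        (1 - nexp (ENNReal.ofReal (cellRate lam M n q))) := by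
  have hπ := Real.pi_pos
  rw [ENNReal.mul_sub fun _ _ => nexp_ne_top _, mul_one, ← nexp_add, ← Finset.sum_range_succ,
    sum_cellRate hlam, sum_cellRate hlam, nexp_ofReal (by positivity), nexp_ofReal (by positivity),
    ← ENNReal.ofReal_sub _ (by positivity), closestMeasure, withDensity_level_eq,
    setLIntegral_Ioc_ofReal (by positivity) (by gcongr; linarith) (by fun_prop)
    (fun r hr => closestDensity_nonneg hlam hr)
    (g := fun r => -Real.exp (-(lam * Real.pi / M * r ^ 2))) fun r => ?_]
  · congr 1
    push_cast
    ring
  · refine ((((hasDerivAt_pow 2 r).const_mul (lam * Real.pi / M)).neg.exp).neg).congr_deriv ?_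
    have e : (-fun y => lam * Real.pi / M * y ^ 2) r = -(lam * Real.pi * r ^ 2 / M) := by
      simp only [Pi.neg_apply]
      ring
    rw [closestDensity, e]
    push_cast
    ring

lemma lintegral_comp_level (ν : Measure ℝ) (n : ℕ) (s : Finset ℕ) {ψ : ℕ → ℝ≥0∞}
    (hψ : ∀ q ∉ s, ψ q = 0) :
    ∫⁻ r, ψ (level n r) ∂ν = ∑ q ∈ s, ψ q * ν {r | level n r = q} := by
  rw [← lintegral_map measurable_from_top (measurable_level n), lintegral_countable',
    tsum_eq_sum fun q hq => by rw [hψ q hq, zero_mul]]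
  refine Finset.sum_congr rfl fun q _ => ?_
  rw [Measure.map_apply (measurable_level n) (measurableSet_singleton q)]
  rfl

end Measures

/-! ### The transform of the exponent -/

open Classical in
/-- The `k`-th moment of the detection probability. -/
noncomputable def detectMoment (l : ℝ → ℝ) (M : ℕ) (Γ Pw W lam : ℝ) (k : ℕ) : ℝ≥0∞ :=
  ∫⁻ r₁, nexp (k * ENNReal.ofReal (W * Γ * l r₁ / (Pw * M))) *
    nexp (∫⁻ r, (if r₁ < r then ENNReal.ofReal (1 - (1 / (1 + Γ * l r₁ / l r)) ^ k) else 0)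
      ∂(radialMeasure lam M)) ∂(closestMeasure lam M)

section Limit

variable {l : ℝ → ℝ} {RC : ℝ} {M : ℕ} {Γ Pw W lam : ℝ}

/-- The cell probabilities and rates are exact masses of `closestMeasure` and `radialMeasure`. The
sum is therefore an integral of step functions against measures free of `n`, and only the integrands
have to converge. -/
lemma levelSum_eq_lintegral (hlam : 0 ≤ lam) (k n : ℕ) :
    ∑ q ∈ Finset.range (4 ^ n),
        nexp (k * ENNReal.ofReal (W * Γ * l ((q : ℝ) / 2 ^ n) / (Pw * M))) *
          (nexp (∑ p ∈ Finset.range q, ENNReal.ofReal (cellRate lam M n p)) *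
            (1 - nexp (ENNReal.ofReal (cellRate lam M n q))) *
            nexp (∑ p ∈ Finset.Ioo q (4 ^ n), ENNReal.ofReal (cellRate lam M n p *
              (1 - (1 / (1 + levelRatio l Γ n q p)) ^ k)))) =
    ∫⁻ r₁, (if level n r₁ < 4 ^ n then
      nexp (k * ENNReal.ofReal (W * Γ * l ((level n r₁ : ℝ) / 2 ^ n) / (Pw * M))) *
        nexp (∫⁻ r, (if level n r₁ < level n r ∧ level n r < 4 ^ n then
          ENNReal.ofReal (1 - (1 / (1 + levelRatio l Γ n (level n r₁) (level n r))) ^ k) else 0)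
          ∂(radialMeasure lam M)) else 0) ∂(closestMeasure lam M) := by
  rw [lintegral_comp_level (closestMeasure lam M) n (Finset.range (4 ^ n)) (ψ := fun q =>
    if q < 4 ^ n then nexp (k * ENNReal.ofReal (W * Γ * l ((q : ℝ) / 2 ^ n) / (Pw * M))) *
        nexp (∫⁻ r, (if q < level n r ∧ level n r < 4 ^ n then
          ENNReal.ofReal (1 - (1 / (1 + levelRatio l Γ n q (level n r))) ^ k) else 0)
          ∂(radialMeasure lam M)) else 0) fun q hq => if_neg fun h => hq (Finset.mem_range.2 h)]
  refine Finset.sum_congr rfl fun q hq => ?_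
  rw [if_pos (Finset.mem_range.1 hq), closestMeasure_level_eq hlam,
    lintegral_comp_level (radialMeasure lam M) n (Finset.Ioo q (4 ^ n)) (ψ := fun p =>
      if q < p ∧ p < 4 ^ n then
        ENNReal.ofReal (1 - (1 / (1 + levelRatio l Γ n q p)) ^ k) else 0)
      fun p hp => if_neg fun h => hp (Finset.mem_Ioo.2 h)]
  have e : ∀ p ∈ Finset.Ioo q (4 ^ n), (if q < p ∧ p < 4 ^ n then
      ENNReal.ofReal (1 - (1 / (1 + levelRatio l Γ n q p)) ^ k) else 0) *
        radialMeasure lam M {r | level n r = p} =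
      ENNReal.ofReal (cellRate lam M n p * (1 - (1 / (1 + levelRatio l Γ n q p)) ^ k)) := by
    intro p hp
    rw [if_pos (Finset.mem_Ioo.1 hp), radialMeasure_level_eq hlam,
      ENNReal.ofReal_mul (cellRate_nonneg hlam), mul_comm]
  rw [Finset.sum_congr rfl e]
  ring

lemma measurable_comp_level {f : ℕ → ℝ≥0∞} (n : ℕ) : Measurable fun r => f (level n r) :=
  measurable_from_top.comp (measurable_level n)

lemma tendsto_lintegral_levelRatio (hl : IsPathLoss l RC) (hΓ : 0 < Γ) (k : ℕ) {r₁ : ℝ}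
    (hr₁ : 0 < r₁) (hrC : r₁ ≠ RC) :
    Tendsto (fun n => ∫⁻ r, (if level n r₁ < level n r ∧ level n r < 4 ^ n then
      ENNReal.ofReal (1 - (1 / (1 + levelRatio l Γ n (level n r₁) (level n r))) ^ k) else 0)
        ∂(radialMeasure lam M)) atTop
      (𝓝 (∫⁻ r, (if r₁ < r then ENNReal.ofReal (1 - (1 / (1 + Γ * l r₁ / l r)) ^ k) else 0)
        ∂(radialMeasure lam M))) := by
  refine tendsto_lintegral_of_le (fun n => ?_) (fun n => ?_) ?_
  · exact (measurable_comp_level (f := fun p => if level n r₁ < p ∧ p < 4 ^ n then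
      ENNReal.ofReal (1 - (1 / (1 + levelRatio l Γ n (level n r₁) p)) ^ k) else 0) n).aemeasurable
  · refine ae_radialMeasure (Eventually.of_forall fun r hr => level_ite_le ?_)
    have h1 := levelRatio_nonneg hl hΓ n (level n r₁) (level n r)
    have h2 := levelRatio_le hl hΓ hr₁.le hr n
    have h3 := h1.trans h2
    refine ENNReal.ofReal_le_ofReal ?_
    gcongr
  · refine ae_radialMeasure ?_
    filter_upwards [Measure.ae_ne volume RC, Measure.ae_ne volume r₁] with r h1 h2 hr
    have hs : 0 ≤ Γ * l r₁ / l r := by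
      have := hl.nonneg _ hr₁.le
      have := hl.nonneg _ hr.le
      positivity
    refine tendsto_level_ite hr₁.le h2.symm (ENNReal.tendsto_ofReal ?_)
    refine Tendsto.const_sub 1 (Tendsto.pow (tendsto_const_nhds.div ?_ (by linarith)) k)
    exact (tendsto_levelRatio hl hr₁ hrC hr h1).const_add 1

/-- The outer integrands are bounded by `1` on a finite measure. The remaining term, the probability
of no point within radius `2 ^ n`, is `exp (-lam π 4ⁿ / M)` and vanishes. -/
lemma tendsto_levelSum (hl : IsPathLoss l RC) (hlam : 0 < lam) (hM : 1 ≤ M) (hΓ : 0 < Γ) (k : ℕ) :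
    Tendsto (fun n : ℕ => (∑ q ∈ Finset.range (4 ^ n),
        nexp (k * ENNReal.ofReal (W * Γ * l ((q : ℝ) / 2 ^ n) / (Pw * M))) *
          (nexp (∑ p ∈ Finset.range q, ENNReal.ofReal (cellRate lam M n p)) *
            (1 - nexp (ENNReal.ofReal (cellRate lam M n q))) *
            nexp (∑ p ∈ Finset.Ioo q (4 ^ n), ENNReal.ofReal (cellRate lam M n p *
              (1 - (1 / (1 + levelRatio l Γ n q p)) ^ k))))) +
      nexp (∑ p ∈ Finset.range (4 ^ n), ENNReal.ofReal (cellRate lam M n p))) atTop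
      (𝓝 (detectMoment l M Γ Pw W lam k)) := by
  have hM' : (0 : ℝ) < M := by exact_mod_cast hM
  have hπ := Real.pi_pos
  have := isFiniteMeasure_closestMeasure hlam hM
  simp only [levelSum_eq_lintegral hlam.le]
  simp only [sum_cellRate hlam.le]
  rw [← add_zero (detectMoment l M Γ Pw W lam k)]
  refine Tendsto.add ?_ ?_
  · refine tendsto_lintegral_of_dominated_convergence (fun _ => 1) (fun n => ?_) (fun n => ?_)
      (by simp) ?_
    · exact measurable_comp_level (f := fun q => if q < 4 ^ n then
        nexp (k * ENNReal.ofReal (W * Γ * l ((q : ℝ) / 2 ^ n) / (Pw * M))) *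
        nexp (∫⁻ r, (if q < level n r ∧ level n r < 4 ^ n then
          ENNReal.ofReal (1 - (1 / (1 + levelRatio l Γ n q (level n r))) ^ k) else 0)
          ∂(radialMeasure lam M)) else 0) n
    · refine Eventually.of_forall fun r => ?_
      simp only
      split_ifs
      · exact mul_le_one' (nexp_le_one _) (nexp_le_one _)
      · exact zero_le
    · refine ae_closestMeasure ?_
      filter_upwards [Measure.ae_ne volume RC] with r₁ hrC hr₁
      refine Tendsto.congr' ((eventually_level_lt hr₁.le).mono fun n hn => (if_pos hn).symm) ?_
      simp only [← nexp_add]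
      refine (continuous_nexp.tendsto _).comp (Tendsto.add ?_
        (tendsto_lintegral_levelRatio hl hΓ k hr₁ hrC))
      refine ENNReal.Tendsto.const_mul (ENNReal.tendsto_ofReal
        (Tendsto.div_const (Tendsto.const_mul _ ?_) _)) (Or.inr (by simp))
      exact (hl.continuousAt _ hr₁ hrC).tendsto.comp (tendsto_level_div hr₁.le)
  · rw [← nexp_top]
    refine (continuous_nexp.tendsto _).comp (ENNReal.tendsto_ofReal_atTop.comp ?_)
    have e : (fun n : ℕ => lam * Real.pi / M * (((4 ^ n : ℕ) : ℝ) / 2 ^ n) ^ 2) =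
        fun n : ℕ => lam * Real.pi / M * (4 : ℝ) ^ n := by
      funext n
      push_cast
      rw [← div_pow, ← pow_mul, mul_comm n 2, pow_mul]
      norm_num
    rw [e]
    exact (tendsto_pow_atTop_atTop_of_one_lt (by norm_num)).const_mul_atTop (by positivity)

variable {Ω : Type*} [MeasurableSpace Ω] {μ : Measure Ω} [IsProbabilityMeasure μ]
  {X : ℕ → Ω → ℂ} {i : ℕ}

lemma tendsto_lintegral_nexp_levelExponent (hl : IsPathLoss l RC)
    (hX : IsPoissonPointProcess X lam μ) (hlam : 0 < lam) (hΓ : 0 < Γ) (h1 : 1 ≤ i) (hi : i ≤ M)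
    (k : ℕ) :
    Tendsto (fun n => ∫⁻ ω, nexp (levelExponent l M Γ Pw W n
      (levelCount M (fun m => X m ω) i n)) ^ k ∂μ) atTop
      (𝓝 (detectMoment l M Γ Pw W lam k)) := by
  simp only [← nexp_natCast_mul, lintegral_nexp_levelExponent hl hX hlam.le hΓ h1 hi]
  exact tendsto_levelSum hl hlam (h1.trans hi) hΓ k

end Limit

/-! ### Integral formula for the moments of the detection probability -/

section Formula

variable {l : ℝ → ℝ} {RC : ℝ} {M : ℕ} {Γ Pw W lam : ℝ}

open Classical in
lemma measurable_lintegral_radialMeasure (hl : Measurable l) (k : ℕ) :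
    Measurable fun r₁ => ∫⁻ r, (if r₁ < r then
      ENNReal.ofReal (1 - (1 / (1 + Γ * l r₁ / l r)) ^ k) else 0) ∂(radialMeasure lam M) := by
  have hs : SFinite (radialMeasure lam M) := by
    unfold radialMeasure
    infer_instance
  refine Measurable.lintegral_prod_right' (f := fun p : ℝ × ℝ => if p.1 < p.2 then
      ENNReal.ofReal (1 - (1 / (1 + Γ * l p.1 / l p.2)) ^ k) else 0) ?_
  exact Measurable.ite (measurableSet_lt measurable_fst measurable_snd) (by fun_prop)
    measurable_const

open Classical in
lemma interferenceFactor_eq (hl : Measurable l) (k : ℕ) {r₁ : ℝ}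
    (hr₁ : 0 < r₁) : interferenceFactor l M Γ lam k r₁ =
      (nexp (∫⁻ r, (if r₁ < r then ENNReal.ofReal (1 - (1 / (1 + Γ * l r₁ / l r)) ^ k) else 0)
        ∂(radialMeasure lam M))).toReal := by
  have hπ := Real.pi_pos
  have hm : Measurable fun r => if r₁ < r then
      ENNReal.ofReal (1 - (1 / (1 + Γ * l r₁ / l r)) ^ k) else 0 :=
    Measurable.ite measurableSet_Ioi (by fun_prop) measurable_const
  have e : ∫⁻ r, (if r₁ < r then ENNReal.ofReal (1 - (1 / (1 + Γ * l r₁ / l r)) ^ k) else 0)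
      ∂(radialMeasure lam M) = ENNReal.ofReal (2 * Real.pi * lam / M) *
      ∫⁻ r in Ioi r₁, ENNReal.ofReal ((1 - 1 / (1 + Γ * l r₁ / l r) ^ k) * r) := by
    rw [radialMeasure, lintegral_withDensity_eq_lintegral_mul _ (by fun_prop) hm,
      ← lintegral_const_mul _ (by fun_prop), ← lintegral_indicator measurableSet_Ioi,
      ← lintegral_indicator measurableSet_Ioi]
    refine lintegral_congr fun r => ?_
    by_cases h : r₁ < r
    · have h0 : 0 < r := hr₁.trans h
      rw [indicator_of_mem (mem_Ioi.2 h0), indicator_of_mem (mem_Ioi.2 h), Pi.mul_apply, if_pos h,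
        one_div_pow, ENNReal.ofReal_mul' h0.le, ENNReal.ofReal_mul' h0.le]
      ring
    · rw [indicator_of_notMem (s := Ioi r₁) h]
      by_cases h0 : 0 < r
      · rw [indicator_of_mem (mem_Ioi.2 h0), Pi.mul_apply, if_neg h, mul_zero]
      · rw [indicator_of_notMem (s := Ioi (0 : ℝ)) h0]
  rw [e]
  rfl

/-- The contribution of the `k`-th power of the detection probability to the integrand of the
formula for `A_j`. -/
noncomputable def detectMomentIntegrand (l : ℝ → ℝ) (M : ℕ) (Γ Pw W lam : ℝ) (k : ℕ) (r₁ : ℝ) :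
    ℝ :=
  Real.exp (-(W * k * Γ * l r₁ / (Pw * M))) * interferenceFactor l M Γ lam k r₁ *
    closestDensity lam M r₁

lemma integrableOn_detectMomentIntegrand_and_integral (hl : IsPathLoss l RC) (hlam : 0 < lam)
    (hM : 1 ≤ M) (hΓ : 0 < Γ) (hPw : 0 < Pw) (hW : 0 ≤ W) (k : ℕ) :
    IntegrableOn (detectMomentIntegrand l M Γ Pw W lam k) (Ioi 0) ∧
      ∫ r₁ in Ioi 0, detectMomentIntegrand l M Γ Pw W lam k r₁ =
        (detectMoment l M Γ Pw W lam k).toReal := by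
  classical
  have := isFiniteMeasure_closestMeasure hlam hM
  set H : ℝ → ℝ≥0∞ := fun r₁ => nexp (k * ENNReal.ofReal (W * Γ * l r₁ / (Pw * M))) *
    nexp (∫⁻ r, (if r₁ < r then ENNReal.ofReal (1 - (1 / (1 + Γ * l r₁ / l r)) ^ k) else 0)
      ∂(radialMeasure lam M)) with hH
  have hHm : Measurable H := by
    have := hl.measurable
    have h2 := measurable_lintegral_radialMeasure (Γ := Γ) (lam := lam) (M := M) this k
    simp only [hH]
    exact Measurable.mul (by fun_prop) (measurable_nexp.comp h2)
  have hH1 : ∀ r, H r ≤ 1 := fun r => mul_le_one' (nexp_le_one _) (nexp_le_one _)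
  have hd : Measurable fun r => ENNReal.ofReal (closestDensity lam M r) := by fun_prop
  have hHi : Integrable (fun r => (H r).toReal) (closestMeasure lam M) := by
    refine Integrable.of_bound hHm.ennreal_toReal.aestronglyMeasurable 1
      (Eventually.of_forall fun r => ?_)
    rw [Real.norm_of_nonneg ENNReal.toReal_nonneg]
    simpa using ENNReal.toReal_mono ENNReal.one_ne_top (hH1 r)
  have he : EqOn (fun r => (ENNReal.ofReal (closestDensity lam M r)).toReal • (H r).toReal)
      (detectMomentIntegrand l M Γ Pw W lam k) (Ioi 0) := by
    intro r hr
    have h0 := hl.nonneg r (le_of_lt hr)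
    simp only [smul_eq_mul]
    rw [detectMomentIntegrand, ENNReal.toReal_ofReal (closestDensity_nonneg hlam.le (le_of_lt hr)),
      interferenceFactor_eq hl.measurable k hr, mul_comm]
    congr 1
    simp only [hH]
    rw [ENNReal.toReal_mul]
    congr 1
    rw [← ENNReal.ofReal_natCast, ← ENNReal.ofReal_mul (by positivity),
      nexp_ofReal (by positivity), ENNReal.toReal_ofReal (by positivity)]
    congr 1
    ring
  constructor
  · refine IntegrableOn.congr_fun ?_ he measurableSet_Ioi
    exact (integrable_withDensity_iff_integrable_smul' hd
      (Eventually.of_forall fun _ => ENNReal.ofReal_lt_top)).1 hHi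
  · rw [← setIntegral_congr_fun measurableSet_Ioi he,
      ← integral_withDensity_eq_integral_toReal_smul hd
        (Eventually.of_forall fun _ => ENNReal.ofReal_lt_top)]
    exact integral_toReal hHm.aemeasurable
      (Eventually.of_forall fun r => (hH1 r).trans_lt ENNReal.one_lt_top)

lemma missIntegrand_eq (j : ℕ) (r₁ : ℝ) : missIntegrand l M Γ Pw W lam j r₁ =
    ∑ k ∈ Finset.range (j + 1), (-1) ^ k * (j.choose k : ℝ) *
      detectMomentIntegrand l M Γ Pw W lam k r₁ := by
  rw [missIntegrand, Finset.sum_mul]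
  refine Finset.sum_congr rfl fun k _ => ?_
  simp only [detectMomentIntegrand, closestDensity]
  ring

lemma integrableOn_missIntegrand (hl : IsPathLoss l RC) (hlam : 0 < lam) (hM : 1 ≤ M)
    (hΓ : 0 < Γ) (hPw : 0 < Pw) (hW : 0 ≤ W) (j : ℕ) :
    IntegrableOn (missIntegrand l M Γ Pw W lam j) (Ioi 0) := by
  rw [funext (missIntegrand_eq j)]
  exact integrable_finsetSum _ fun k _ =>
    (integrableOn_detectMomentIntegrand_and_integral hl hlam hM hΓ hPw hW k).1.const_mul _

lemma integral_missIntegrand (hl : IsPathLoss l RC) (hlam : 0 < lam) (hM : 1 ≤ M)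
    (hΓ : 0 < Γ) (hPw : 0 < Pw) (hW : 0 ≤ W) (j : ℕ) :
    ∫ r₁ in Ioi 0, missIntegrand l M Γ Pw W lam j r₁ =
      ∑ k ∈ Finset.range (j + 1), (-1) ^ k * (j.choose k : ℝ) *
        (detectMoment l M Γ Pw W lam k).toReal := by
  have h := integrableOn_detectMomentIntegrand_and_integral hl hlam hM hΓ hPw hW
  simp only [missIntegrand_eq]
  rw [integral_finsetSum _ fun k _ => (h k).1.const_mul _]
  refine Finset.sum_congr rfl fun k _ => ?_
  rw [integral_const_mul, (h k).2]

end Formula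

/-! ### Moments of the detection probabilities -/

section Moments

variable {l : ℝ → ℝ} {RC : ℝ} {M : ℕ} {Γ Pw W lam : ℝ}
variable {Ω : Type*} [MeasurableSpace Ω] {μ : Measure Ω} {X : ℕ → Ω → ℂ} {i : ℕ}

lemma measurable_levelCount_pi (hX : IsPoissonPointProcess X lam μ) (i n : ℕ) :
    Measurable fun ω => levelCount M (fun m => X m ω) i n :=
  measurable_pi_lambda _ fun q => measurable_levelCount hX i n q

variable [IsProbabilityMeasure μ]

/-- The approximation at level `n` of the detection probability in sector `i`. -/
noncomputable def levelDetectProb (l : ℝ → ℝ) (M : ℕ) (Γ Pw W : ℝ) (n : ℕ) (N : ℕ → ℝ≥0∞) : ℝ :=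
  (nexp (levelExponent l M Γ Pw W n N)).toReal

lemma measurable_levelDetectProb (n : ℕ) : Measurable (levelDetectProb l M Γ Pw W n) :=
  (measurable_nexp.comp (measurable_levelExponent n)).ennreal_toReal

lemma levelDetectProb_mem (n : ℕ) (N : ℕ → ℝ≥0∞) :
    levelDetectProb l M Γ Pw W n N ∈ Icc (0 : ℝ) 1 :=
  ⟨ENNReal.toReal_nonneg, toReal_nexp_le_one _⟩

lemma ae_tendsto_levelDetectProb (hl : IsPathLoss l RC) (hX : IsPoissonPointProcess X lam μ)
    (hlam : 0 < lam) (hΓ : 0 < Γ) (hPw : 0 < Pw) (hW : 0 ≤ W) (h1 : 1 ≤ i) (hi : i ≤ M) :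
    ∀ᵐ ω ∂μ, Tendsto (fun n => levelDetectProb l M Γ Pw W n (levelCount M (fun m => X m ω) i n))
      atTop (𝓝 (detectProb l M Γ Pw W (fun m => X m ω) i)) := by
  filter_upwards [ae_isRegular (M := M) hX hlam RC] with ω hω
  obtain ⟨k, hk⟩ := hω.exists_isClosest h1 hi
  rw [hk.detectProb_eq hl hΓ hPw hW]
  exact (ENNReal.tendsto_toReal (nexp_ne_top _)).comp
    ((continuous_nexp.tendsto _).comp (tendsto_levelExponent hl hω hk hΓ))

lemma aemeasurable_detectProb (hl : IsPathLoss l RC) (hX : IsPoissonPointProcess X lam μ)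
    (hlam : 0 < lam) (hΓ : 0 < Γ) (hPw : 0 < Pw) (hW : 0 ≤ W) (h1 : 1 ≤ i) (hi : i ≤ M) :
    AEMeasurable (fun ω => detectProb l M Γ Pw W (fun m => X m ω) i) μ :=
  aemeasurable_of_tendsto_metrizable_ae atTop
    (fun n => ((measurable_levelDetectProb n).comp (measurable_levelCount_pi hX i n)).aemeasurable)
    (ae_tendsto_levelDetectProb hl hX hlam hΓ hPw hW h1 hi)

lemma ae_detectProb_mem (hl : IsPathLoss l RC) (hX : IsPoissonPointProcess X lam μ)
    (hlam : 0 < lam) (hΓ : 0 < Γ) (hPw : 0 < Pw) (hW : 0 ≤ W) (h1 : 1 ≤ i) (hi : i ≤ M) :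
    ∀ᵐ ω ∂μ, detectProb l M Γ Pw W (fun m => X m ω) i ∈ Icc (0 : ℝ) 1 := by
  filter_upwards [ae_tendsto_levelDetectProb hl hX hlam hΓ hPw hW h1 hi] with ω hω
  exact isClosed_Icc.mem_of_tendsto hω (Eventually.of_forall fun n => levelDetectProb_mem n _)

/-- The moments of the discretised probabilities have two limits: one by almost sure bounded
convergence, one by the explicit transform. -/
lemma integral_detectProb_pow (hl : IsPathLoss l RC) (hX : IsPoissonPointProcess X lam μ)
    (hlam : 0 < lam) (hΓ : 0 < Γ) (hPw : 0 < Pw) (hW : 0 ≤ W) (h1 : 1 ≤ i) (hi : i ≤ M) (k : ℕ) :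
    ∫ ω, detectProb l M Γ Pw W (fun m => X m ω) i ^ k ∂μ =
      (detectMoment l M Γ Pw W lam k).toReal := by
  have hle : detectMoment l M Γ Pw W lam k ≠ ∞ := by
    refine ne_top_of_le_ne_top ENNReal.one_ne_top (le_of_tendsto'
      (tendsto_lintegral_nexp_levelExponent (Pw := Pw) (W := W) hl hX hlam hΓ h1 hi k) fun n => ?_)
    calc _ ≤ ∫⁻ _, 1 ∂μ := lintegral_mono fun ω => pow_le_one' (nexp_le_one _) k
      _ = 1 := by simp
  have hm : ∀ n, Measurable fun ω =>
      levelDetectProb l M Γ Pw W n (levelCount M (fun m => X m ω) i n) := fun n =>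
    (measurable_levelDetectProb n).comp (measurable_levelCount_pi hX i n)
  refine tendsto_nhds_unique (f := fun n => ∫ ω,
    levelDetectProb l M Γ Pw W n (levelCount M (fun m => X m ω) i n) ^ k ∂μ) (l := atTop) ?_ ?_
  · refine tendsto_integral_of_dominated_convergence (fun _ => 1)
      (fun n => ((hm n).pow_const k).aestronglyMeasurable) (integrable_const 1)
      (fun n => Eventually.of_forall fun ω => ?_) ?_
    · have h := levelDetectProb_mem (l := l) (M := M) (Γ := Γ) (Pw := Pw) (W := W) n
        (levelCount M (fun m => X m ω) i n)
      rw [Real.norm_of_nonneg (pow_nonneg h.1 k)]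
      exact pow_le_one₀ h.1 h.2
    · filter_upwards [ae_tendsto_levelDetectProb hl hX hlam hΓ hPw hW h1 hi] with ω hω
      exact hω.pow k
  · have h := (ENNReal.tendsto_toReal hle).comp
      (tendsto_lintegral_nexp_levelExponent (Pw := Pw) (W := W) hl hX hlam hΓ h1 hi k)
    refine h.congr fun n => ?_
    simp only [Function.comp, levelDetectProb, ← ENNReal.toReal_pow]
    refine (integral_toReal ?_ (Eventually.of_forall fun ω => ?_)).symm
    · exact (((measurable_nexp.comp (measurable_levelExponent n)).comp
        (measurable_levelCount_pi hX i n)).pow_const k).aemeasurable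
    · exact (pow_le_one' (nexp_le_one _) k).trans_lt ENNReal.one_lt_top

lemma integrable_pow_of_ae_mem_Icc {f : Ω → ℝ} (hf : AEMeasurable f μ)
    (h01 : ∀ᵐ ω ∂μ, f ω ∈ Icc (0 : ℝ) 1) (k : ℕ) : Integrable (fun ω => f ω ^ k) μ := by
  refine Integrable.of_bound (hf.pow_const k).aestronglyMeasurable 1 ?_
  filter_upwards [h01] with ω h
  rw [Real.norm_of_nonneg (pow_nonneg h.1 k)]
  exact pow_le_one₀ h.1 h.2

lemma integrable_one_sub_detectProb_pow (hl : IsPathLoss l RC)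
    (hX : IsPoissonPointProcess X lam μ) (hlam : 0 < lam) (hΓ : 0 < Γ) (hPw : 0 < Pw)
    (hW : 0 ≤ W) (h1 : 1 ≤ i) (hi : i ≤ M) (j : ℕ) :
    Integrable (fun ω => (1 - detectProb l M Γ Pw W (fun m => X m ω) i) ^ j) μ := by
  refine integrable_pow_of_ae_mem_Icc
    ((aemeasurable_detectProb hl hX hlam hΓ hPw hW h1 hi).const_sub 1) ?_ j
  filter_upwards [ae_detectProb_mem hl hX hlam hΓ hPw hW h1 hi] with ω h
  exact ⟨by linarith [h.2], by linarith [h.1]⟩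

/-- The right-hand side does not involve `i`; this is how the equality of the moments across sectors
is obtained, without rotating the process. -/
lemma integral_one_sub_detectProb_pow (hl : IsPathLoss l RC)
    (hX : IsPoissonPointProcess X lam μ) (hlam : 0 < lam) (hΓ : 0 < Γ) (hPw : 0 < Pw)
    (hW : 0 ≤ W) (h1 : 1 ≤ i) (hi : i ≤ M) (j : ℕ) :
    ∫ ω, (1 - detectProb l M Γ Pw W (fun m => X m ω) i) ^ j ∂μ =
      ∫ r₁ in Ioi 0, missIntegrand l M Γ Pw W lam j r₁ := by
  have hint : ∀ k, Integrable (fun ω => detectProb l M Γ Pw W (fun m => X m ω) i ^ k) μ :=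
    integrable_pow_of_ae_mem_Icc (aemeasurable_detectProb hl hX hlam hΓ hPw hW h1 hi)
      (ae_detectProb_mem hl hX hlam hΓ hPw hW h1 hi)
  have e : ∀ D : ℝ, (1 - D) ^ j =
      ∑ k ∈ Finset.range (j + 1), (-1) ^ k * (j.choose k : ℝ) * D ^ k := by
    intro D
    rw [sub_eq_add_neg, add_comm, add_pow]
    refine Finset.sum_congr rfl fun k _ => ?_
    rw [neg_pow]
    simp only [one_pow, mul_one]
    ring
  simp only [e]
  rw [integral_finsetSum _ fun k _ => (hint k).const_mul _,
    integral_missIntegrand hl hlam (h1.trans hi) hΓ hPw hW]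
  refine Finset.sum_congr rfl fun k _ => ?_
  rw [integral_const_mul, integral_detectProb_pow hl hX hlam hΓ hPw hW h1 hi]

/-- The cell counts of different sectors are independent, so the expectation factorises at each
level `n`; bounded convergence transfers this to the true probabilities. -/
lemma integral_prod_one_sub_detectProb_pow (hl : IsPathLoss l RC)
    (hX : IsPoissonPointProcess X lam μ) (hlam : 0 < lam) (hM : 1 ≤ M) (hΓ : 0 < Γ)
    (hPw : 0 < Pw) (hW : 0 ≤ W) (j : ℕ) :
    ∫ ω, ∏ i ∈ Finset.Icc 1 M, (1 - detectProb l M Γ Pw W (fun m => X m ω) i) ^ j ∂μ =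
      missMoment μ l M Γ Pw W X j ^ M := by
  let D : ℕ → ℕ → Ω → ℝ := fun n i ω =>
    (1 - levelDetectProb l M Γ Pw W n (levelCount M (fun m => X m ω) i n)) ^ j
  have hDm : ∀ n i, Measurable (D n i) := fun n i =>
    (((measurable_levelDetectProb n).comp
      (measurable_levelCount_pi hX i n)).const_sub 1).pow_const j
  have hD1 : ∀ n i ω, D n i ω ∈ Icc (0 : ℝ) 1 := by
    intro n i ω
    have h := levelDetectProb_mem (l := l) (M := M) (Γ := Γ) (Pw := Pw) (W := W) n
        (levelCount M (fun m => X m ω) i n)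
    exact ⟨pow_nonneg (by linarith [h.2]) j, pow_le_one₀ (by linarith [h.2]) (by linarith [h.1])⟩
  have hlim : ∀ i ∈ Finset.Icc 1 M, ∀ᵐ ω ∂μ, Tendsto (fun n => D n i ω) atTop
      (𝓝 ((1 - detectProb l M Γ Pw W (fun m => X m ω) i) ^ j)) := by
    intro i hi
    rw [Finset.mem_Icc] at hi
    filter_upwards [ae_tendsto_levelDetectProb hl hX hlam hΓ hPw hW hi.1 hi.2] with ω hω
    exact (hω.const_sub 1).pow j
  have hprod : ∀ n, ∫ ω, ∏ i ∈ Finset.Icc 1 M, D n i ω ∂μ =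
      ∏ i ∈ Finset.Icc 1 M, ∫ ω, D n i ω ∂μ := by
    intro n
    have h := ((iIndepFun_levelCount_sectors hX hM n).comp
      (fun _ N => (1 - levelDetectProb l M Γ Pw W n N) ^ j)
      fun _ => ((measurable_levelDetectProb n).const_sub 1).pow_const j)
    have h2 := h.integral_fun_prod_eq_prod_integral
      fun i => (hDm n i).aestronglyMeasurable
    rw [← Finset.prod_coe_sort (Finset.Icc 1 M) fun i => ∫ ω, D n i ω ∂μ]
    refine Eq.trans (integral_congr_ae (Eventually.of_forall fun ω => ?_)) h2
    exact (Finset.prod_coe_sort (Finset.Icc 1 M) fun i => D n i ω).symm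
  have hmiss : ∀ i ∈ Finset.Icc 1 M,
      ∫ ω, (1 - detectProb l M Γ Pw W (fun m => X m ω) i) ^ j ∂μ =
        missMoment μ l M Γ Pw W X j := by
    intro i hi
    rw [Finset.mem_Icc] at hi
    rw [missMoment, integral_one_sub_detectProb_pow hl hX hlam hΓ hPw hW hi.1 hi.2,
      integral_one_sub_detectProb_pow hl hX hlam hΓ hPw hW le_rfl hM]
  have hR : ∏ i ∈ Finset.Icc 1 M, ∫ ω, (1 - detectProb l M Γ Pw W (fun m => X m ω) i) ^ j ∂μ =
      missMoment μ l M Γ Pw W X j ^ M := by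
    rw [Finset.prod_congr rfl hmiss, Finset.prod_const, Nat.card_Icc, Nat.add_sub_cancel]
  rw [← hR]
  refine tendsto_nhds_unique (f := fun n => ∫ ω, ∏ i ∈ Finset.Icc 1 M, D n i ω ∂μ)
    (l := atTop) ?_ ?_
  · refine tendsto_integral_of_dominated_convergence (fun _ => 1)
      (fun n => (Finset.measurable_prod _ fun i _ => hDm n i).aestronglyMeasurable)
      (integrable_const 1) (fun n => Eventually.of_forall fun ω => ?_) ?_
    · rw [Real.norm_of_nonneg (Finset.prod_nonneg fun i _ => (hD1 n i ω).1)]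
      exact Finset.prod_le_one (fun i _ => (hD1 n i ω).1) fun i _ => (hD1 n i ω).2
    · filter_upwards [(Finset.eventually_all _).2 hlim] with ω hω
      exact tendsto_finsetProd _ fun i hi => hω i hi
  · simp only [hprod]
    refine tendsto_finsetProd _ fun i hi => ?_
    refine tendsto_integral_of_dominated_convergence (fun _ => 1)
      (fun n => (hDm n i).aestronglyMeasurable) (integrable_const 1)
      (fun n => Eventually.of_forall fun ω => ?_) (hlim i hi)
    rw [Real.norm_of_nonneg (hD1 n i ω).1]
    exact (hD1 n i ω).2

end Moments

/-! ### The expected number of cycles -/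

section Cycles

variable {l : ℝ → ℝ} {RC : ℝ} {M : ℕ} {Γ Pw W lam : ℝ}
variable {Ω : Type*} [MeasurableSpace Ω] {μ : Measure Ω}
  {X : ℕ → Ω → ℂ} {F : ℕ → ℕ → Ω → ℝ}

lemma measurableSet_forall_not_cycleSuccess (hl : Measurable l) (M : ℕ) (Γ Pw W : ℝ) (j : ℕ) :
    MeasurableSet {p : (ℕ → ℂ) × (ℕ × ℕ → ℝ) | ∀ n ∈ Finset.Icc 1 j,
      ¬ CycleSuccess l M Γ Pw W p.1 (fun m => p.2 (n, m))} := by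
  have e : {p : (ℕ → ℂ) × (ℕ × ℕ → ℝ) | ∀ n ∈ Finset.Icc 1 j,
      ¬ CycleSuccess l M Γ Pw W p.1 (fun m => p.2 (n, m))} =
      ⋂ n ∈ Finset.Icc 1 j, {p | ¬ CycleSuccess l M Γ Pw W p.1 (fun m => p.2 (n, m))} := by
    ext p
    simp
  rw [e]
  refine Finset.measurableSet_biInter _ fun n _ => MeasurableSet.compl ?_
  exact (by fun_prop : Measurable fun p : (ℕ → ℂ) × (ℕ × ℕ → ℝ) => (p.1, fun m => p.2 (n, m)))
    (measurableSet_cycleSuccess hl M Γ Pw W)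

lemma measurableSet_failure (hl : Measurable l) (hX : ∀ m, Measurable (X m))
    (hF : ∀ n m, Measurable (F n m)) (j : ℕ) :
    MeasurableSet {ω | ∀ n ∈ Finset.Icc 1 j,
      ¬ CycleSuccess l M Γ Pw W (fun m => X m ω) (fun m => F n m ω)} :=
  (by fun_prop : Measurable fun ω => ((fun m => X m ω), fun p : ℕ × ℕ => F p.1 p.2 ω))
    (measurableSet_forall_not_cycleSuccess hl M Γ Pw W j)

lemma measurable_numCycles (hl : Measurable l) (hX : ∀ m, Measurable (X m))
    (hF : ∀ n m, Measurable (F n m)) :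
    Measurable fun ω => numCycles l M Γ Pw W (fun m => X m ω) (fun n m => F n m ω) := by
  simp only [numCycles_eq_tsum]
  exact Measurable.tsum fun j => measurable_one.indicator (measurableSet_failure hl hX hF j)

lemma lintegral_numCycles (hl : Measurable l) (hX : ∀ m, Measurable (X m))
    (hF : ∀ n m, Measurable (F n m)) :
    ∫⁻ ω, numCycles l M Γ Pw W (fun m => X m ω) (fun n m => F n m ω) ∂μ =
      ∑' j : ℕ, μ {ω | ∀ n ∈ Finset.Icc 1 j,
        ¬ CycleSuccess l M Γ Pw W (fun m => X m ω) (fun m => F n m ω)} := by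
  simp only [numCycles_eq_tsum]
  have hm := fun j => measurableSet_failure (M := M) (Γ := Γ) (Pw := Pw) (W := W) hl hX hF j
  have e : ∀ (j : ℕ) (ω : Ω), {j : ℕ | ∀ n ∈ Finset.Icc 1 j,
      ¬ CycleSuccess l M Γ Pw W (fun m => X m ω) (fun m => F n m ω)}.indicator (1 : ℕ → ℝ≥0∞) j =
      {ω | ∀ n ∈ Finset.Icc 1 j,
        ¬ CycleSuccess l M Γ Pw W (fun m => X m ω) (fun m => F n m ω)}.indicator 1 ω :=
    fun _ _ => rfl
  simp only [e]
  rw [lintegral_tsum fun j => (measurable_one.indicator (hm j)).aemeasurable]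
  exact tsum_congr fun j => lintegral_indicator_one (hm j)

variable [IsProbabilityMeasure μ]

lemma measure_failure (hl : IsPathLoss l RC) (hX : IsPoissonPointProcess X lam μ)
    (hlam : 0 < lam) (hM : 1 ≤ M) (hΓ : 0 < Γ) (hPw : 0 < Pw) (hW : 0 ≤ W)
    (hF : ∀ n m, Measurable (F n m)) (hlaw : ∀ n m, μ.map (F n m) = expMeasure 1)
    (hind : iIndepFun (fun (p : ℕ × ℕ) => F p.1 p.2) μ)
    (hXF : IndepFun (fun ω n => X n ω) (fun ω (p : ℕ × ℕ) => F p.1 p.2 ω) μ) (j : ℕ) :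
    μ {ω | ∀ n ∈ Finset.Icc 1 j,
        ¬ CycleSuccess l M Γ Pw W (fun m => X m ω) (fun m => F n m ω)} =
      ENNReal.ofReal (missMoment μ l M Γ Pw W X j) ^ M := by
  have hXm := hX.measurable_point
  have hXp : Measurable fun ω n => X n ω := by fun_prop
  have hFp : Measurable fun ω (p : ℕ × ℕ) => F p.1 p.2 ω := by fun_prop
  have hS := measurableSet_forall_not_cycleSuccess hl.measurable M Γ Pw W j
  have hmap := (indepFun_iff_map_prod_eq_prod_map_map hXp.aemeasurable hFp.aemeasurable).1 hXF
  have : IsProbabilityMeasure (μ.map fun ω (p : ℕ × ℕ) => F p.1 p.2 ω) :=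
    Measure.isProbabilityMeasure_map hFp.aemeasurable
  -- Fubini on the product law of stations and fading: the stations are frozen at `ω` while the
  -- fading is drawn from an independent `ω'`.
  have h1 : μ {ω | ∀ n ∈ Finset.Icc 1 j,
      ¬ CycleSuccess l M Γ Pw W (fun m => X m ω) (fun m => F n m ω)} =
      ∫⁻ ω, μ {ω' | ∀ n ∈ Finset.Icc 1 j,
        ¬ CycleSuccess l M Γ Pw W (fun m => X m ω) (fun m => F n m ω')} ∂μ := by
    have h2 := Measure.map_apply (μ := μ) (hXp.prodMk hFp) hS
    rw [hmap, Measure.prod_apply hS, lintegral_map (measurable_measure_prodMk_left hS) hXp] at h2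
    refine h2.symm.trans (lintegral_congr fun ω => ?_)
    rw [Measure.map_apply hFp (measurable_prodMk_left hS)]
    rfl
  have hmem : ∀ᵐ ω ∂μ, ∀ i ∈ Finset.Icc 1 M,
      detectProb l M Γ Pw W (fun m => X m ω) i ∈ Icc (0 : ℝ) 1 :=
    (Finset.eventually_all _).2 fun i hi => ae_detectProb_mem hl hX hlam hΓ hPw hW
      (Finset.mem_Icc.1 hi).1 (Finset.mem_Icc.1 hi).2
  have hnn : ∀ᵐ ω ∂μ,
      ∏ i ∈ Finset.Icc 1 M, (1 - detectProb l M Γ Pw W (fun m => X m ω) i) ^ j ∈ Icc (0 : ℝ) 1 := by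
    filter_upwards [hmem] with ω h
    have h0 : ∀ i ∈ Finset.Icc 1 M,
        0 ≤ (1 - detectProb l M Γ Pw W (fun m => X m ω) i) ^ j := fun i hi =>
      pow_nonneg (by linarith [(h i hi).2]) j
    refine ⟨Finset.prod_nonneg h0, Finset.prod_le_one h0 fun i hi => ?_⟩
    exact pow_le_one₀ (by linarith [(h i hi).2]) (by linarith [(h i hi).1])
  have hint : Integrable (fun ω =>
      ∏ i ∈ Finset.Icc 1 M, (1 - detectProb l M Γ Pw W (fun m => X m ω) i) ^ j) μ := by
    refine Integrable.of_bound (Finset.aemeasurable_fun_prod _ fun i hi =>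
      ((aemeasurable_detectProb hl hX hlam hΓ hPw hW (Finset.mem_Icc.1 hi).1
        (Finset.mem_Icc.1 hi).2).const_sub 1).pow_const j).aestronglyMeasurable 1 ?_
    filter_upwards [hnn] with ω h
    rw [Real.norm_of_nonneg h.1]
    exact h.2
  have h0 : 0 ≤ missMoment μ l M Γ Pw W X j := by
    refine integral_nonneg_of_ae ?_
    filter_upwards [hmem] with ω h
    exact pow_nonneg (by linarith [(h 1 (Finset.mem_Icc.2 ⟨le_rfl, hM⟩)).2]) j
  rw [h1, ← ENNReal.ofReal_pow h0, ← integral_prod_one_sub_detectProb_pow hl hX hlam hM hΓ hPw hW,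
    ofReal_integral_eq_lintegral_ofReal hint (hnn.mono fun ω h => h.1)]
  refine lintegral_congr_ae ?_
  filter_upwards [ae_isRegular (M := M) hX hlam RC] with ω hω
  exact measure_forall_not_cycleSuccess hl hω hM hΓ hPw hW hF hlaw hind j

end Cycles

end CellSearch

/-! ### The theorem for the dual-slope path loss. -/

theorem mainTheorem4 {Ω : Type*} [MeasurableSpace Ω] (μ : Measure Ω) [IsProbabilityMeasure μ]
    (M : ℕ) (hM : 1 ≤ M) (lam Γ Pw W : ℝ) (hlam : 0 < lam) (hΓ : 0 < Γ) (hPw : 0 < Pw)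
    (hW : 0 ≤ W)
    (CL CN αL αN RC : ℝ) (hCL : 0 < CL) (hCN : 0 < CN) (hRC : 0 < RC) (hα : max αL 2 ≤ αN)
    (hmono : MonotoneOn (CellSearch.dualSlope CL CN αL αN RC) (Ici 0))
    (X : ℕ → Ω → ℂ) (hX : CellSearch.IsPoissonPointProcess X lam μ)
    (F : ℕ → ℕ → Ω → ℝ) (hFmeas : ∀ n m, Measurable (F n m))
    (hFlaw : ∀ n m, μ.map (F n m) = expMeasure 1)
    (hFindep : iIndepFun (fun (p : ℕ × ℕ) => F p.1 p.2) μ)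
    (hXF : IndepFun (fun ω n => X n ω) (fun ω (p : ℕ × ℕ) => F p.1 p.2 ω) μ) :
    (AEMeasurable (fun ω => CellSearch.numCycles (CellSearch.dualSlope CL CN αL αN RC) M Γ Pw W
        (fun m => X m ω) (fun n m => F n m ω)) μ ∧
      ∫⁻ ω, CellSearch.numCycles (CellSearch.dualSlope CL CN αL αN RC) M Γ Pw W
        (fun m => X m ω) (fun n m => F n m ω) ∂μ =
      ∑' j, ENNReal.ofReal
        (CellSearch.missMoment μ (CellSearch.dualSlope CL CN αL αN RC) M Γ Pw W X j) ^ M) ∧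
    ∀ j : ℕ,
      Integrable (fun ω => (1 - CellSearch.detectProb (CellSearch.dualSlope CL CN αL αN RC)
        M Γ Pw W (fun n => X n ω) 1) ^ j) μ ∧
      IntegrableOn (CellSearch.missIntegrand (CellSearch.dualSlope CL CN αL αN RC)
        M Γ Pw W lam j) (Ioi 0) ∧
      CellSearch.missMoment μ (CellSearch.dualSlope CL CN αL αN RC) M Γ Pw W X j =
        ∫ r₁ in Ioi 0, CellSearch.missIntegrand (CellSearch.dualSlope CL CN αL αN RC)
          M Γ Pw W lam j r₁ := by
  have hl := CellSearch.isPathLoss_dualSlope hCL hCN hmono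
  refine ⟨⟨(CellSearch.measurable_numCycles hl.measurable hX.measurable_point
    hFmeas).aemeasurable, ?_⟩, fun j => ⟨?_, ?_, ?_⟩⟩
  · rw [CellSearch.lintegral_numCycles hl.measurable hX.measurable_point hFmeas]
    exact tsum_congr fun j => CellSearch.measure_failure hl hX hlam hM hΓ hPw hW hFmeas hFlaw
      hFindep hXF j
  · exact CellSearch.integrable_one_sub_detectProb_pow hl hX hlam hΓ hPw hW le_rfl hM j
  · exact CellSearch.integrableOn_missIntegrand hl hlam hM hΓ hPw hW j
  · exact CellSearch.integral_one_sub_detectProb_pow hl hX hlam hΓ hPw hW le_rfl hM j
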